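/- Let $F$ be a field, let $D$ be a division algebra with center $F$ and $[D:F]<\infty$, and let $G=D^{\#}=D\setminus\{0\}$ be its multiplicative group. Let $N\trianglelefteq G$ be a normal subgroup with $F^{\#}\le N$ such that $G^*=G/N$ is a finite nonabelian simple group; write $a^*=Na$ for $a\in G$. Notation. Let $\Delta$ be the commuting graph of $G^*$: its vertices are the elements of $G^*\setminus\{1\}$, and distinct vertices are adjacent iff they commute. Let $d$ be its distance function, with $d=\infty$ between different connected components, and let $\operatorname{diam}(\Delta)$ be the supremum of the distances. $\Delta$ is *balanced* if there are vertices $x,y$ such that $xy$ and $x^{-1}y$ are vertices and $d(x,y)$, $d(x,xy)$, $d(y,xy)$, $d(x,x^{-1}y)$, $d(y,x^{-1}y)$ are all greater than $3$. For $a\in G$ put $N(a)=\{n\in N: a+n\in N\}$. For $x\in G^*$ put $$\mathbb P_x=\{a\in G: a^*=x,\ 1\in N(a)\},\qquad \mathbb N_x=\{n\in N: n\in N(a)\text{ for all }a\in\mathbb P_x\},$$ $$\mathbb O_x=\{a\in G: a^*=x,\ -1\notin N(a)\cup N(a^{-1})\}.$$ For a conjugacy class $X$ of $G^*$ put $\mathbb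 P_X=\bigcup_{y\in X}\mathbb P_y$, $\mathbb N_X=\bigcap_{y\in X}\mathbb N_y$, $U_X=\{n\in N: n,n^{-1}\in\mathbb N_X\}$, $\mathbb M_X=\mathbb N_X\setminus U_X$. A set $S\subseteq G$ is said to satisfy the *$U$-Hypothesis* if $S$ is nonempty, invariant under conjugation by $G$, properly contained in $N$, $1,-1\in S$, $S^2=S$ (where $S^2=\{st:s,t\in S\}$), and $n+1\in S$, $n-1\in N$ for all $n\in N\setminus S$. Let $\mathbb O=\{a\in G:\nu(a)=1\}$, where $\nu:G\to F^{\#}$ is the reduced norm, and for a conjugacy class $X$ of $G^*$ put $$\hat K_X=\{a\in \mathbb O U_X\setminus N:\ N(a)\supseteq \mathbb M_X\}.$$ **Theorem.** (1) Suppose $\operatorname{diam}(\Delta)>4$. Then there are conjugacy classes $A^*,B^*\subseteq G^*\setminus\{1\}$ such that - (i) $\mathbb N_{B^*}$ satisfies the $U$-Hypothesis, and - (ii) for every $b\in\mathbb P_{B^*}$ there is $a\in\mathbb P_{A^*}$ with $d(a^*,b^*)>4$ and $N(b)\supseteq N(a)$; and for every pair $A^*,B^*$ of such classes, $\hat K_{B^*}=\mathbb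 O U_{B^*}\setminus N$. (2) Suppose $\Delta$ is balanced. Then there is a conjugacy class $C^*\subseteq G^*\setminus\{1\}$ such that - (i) $\mathbb N_{C^*}$ satisfies the $U$-Hypothesis, and - (ii) either $\mathbb O_x=\emptyset$ for some $x\in G^*\setminus\{1\}$, or for every $m\in\mathbb M_{C^*}$ there is $z\in C^*$ with $m\in N(z_1)$ for all $z_1\in\mathbb O_z$; and for every such class $C^*$, $\hat K_{C^*}=\mathbb O U_{C^*}\setminus N$. -/

import Mathlib

open scoped Pointwise TensorProduct

namespace DivGroup

/-! ### Commuting graph of a group -/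

/-- The commuting graph `Δ(X)`: its vertices are the elements of `X \ {1}`, and two distinct vertices
are adjacent when they commute. Distances and the diameter are taken in `ℕ∞`
(vertices in different components have distance `⊤`). -/
def commutingGraph (X : Type*) [Group X] : SimpleGraph {x : X // x ≠ 1} where
  Adj a b := a ≠ b ∧ (a : X) * b = b * a
  symm := ⟨fun _ _ h => ⟨h.1.symm, h.2.symm⟩⟩
  loopless := ⟨fun _ h => h.1 rfl⟩

/-- `Δ(X)` is balanced: there are vertices `x`, `y` such that the distances `d(x, y)`, `d(x, xy)`,
`d(y, xy)`, `d(x, x⁻¹y)`, `d(y, x⁻¹y)` (between vertices of the graph) are all greater than `3`. -/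
def IsBalanced (X : Type*) [Group X] : Prop :=
  ∃ x y z w : {x : X // x ≠ 1}, (z : X) = x * y ∧ (w : X) = (x : X)⁻¹ * y ∧
    3 < (commutingGraph X).edist x y ∧
    3 < (commutingGraph X).edist x z ∧ 3 < (commutingGraph X).edist y z ∧
    3 < (commutingGraph X).edist x w ∧ 3 < (commutingGraph X).edist y w

/-! ### Elements of reduced norm one -/

section ReducedNorm

variable (F : Type*) {D : Type*} [Field F] [DivisionRing D] [Algebra F D]

/-- `c ∈ F` is the reduced norm of `a ∈ D`, for `D` central and finite-dimensional over `F`: it is the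
determinant of the image of `1 ⊗ a` under a splitting `E ⊗ D ≃ Mₙ(E)`, where `E` is an algebraic
closure of `F`. (By the Skolem-Noether theorem all splittings give the same determinant.) -/
def IsReducedNorm (a : D) (c : F) : Prop :=
  ∃ (n : ℕ) (φ : (AlgebraicClosure F ⊗[F] D) ≃ₐ[AlgebraicClosure F]
      Matrix (Fin n) (Fin n) (AlgebraicClosure F)),
    (φ ((1 : AlgebraicClosure F) ⊗ₜ[F] a)).det = algebraMap F (AlgebraicClosure F) c

/-- The set `𝕆` of elements of `Dˣ` of reduced norm `1`. -/
def normOne : Set Dˣ := {a | IsReducedNorm F (a : D) 1}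

end ReducedNorm

/-! ### The sets attached to a normal subgroup `N` of `Dˣ` -/

section Sets

variable {D : Type*} [DivisionRing D] (N : Subgroup Dˣ)

/-- `N(a) = {n ∈ N : a + n ∈ N}`. -/
def nSet (a : Dˣ) : Set Dˣ := {n | n ∈ N ∧ ∃ m ∈ N, (a : D) + (n : D) = (m : D)}

variable [N.Normal]

/-- `ℙ_x = {a ∈ Dˣ : a* = x, 1 ∈ N(a)}`, for `x ∈ Dˣ ⧸ N`. -/
def pElem (x : Dˣ ⧸ N) : Set Dˣ := {a | (a : Dˣ ⧸ N) = x ∧ 1 ∈ nSet N a}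

/-- `ℕ_x = {n ∈ N : n ∈ N(a) for all a ∈ ℙ_x}`. -/
def nElem (x : Dˣ ⧸ N) : Set Dˣ := {n | n ∈ N ∧ ∀ a ∈ pElem N x, n ∈ nSet N a}

/-- `𝕆_x = {a ∈ Dˣ : a* = x, -1 ∉ N(a) ∪ N(a⁻¹)}`. -/
def oElem (x : Dˣ ⧸ N) : Set Dˣ :=
  {a | (a : Dˣ ⧸ N) = x ∧ -1 ∉ nSet N a ∪ nSet N a⁻¹}

/-- `ℙ_C`, the union of the `ℙ_y` for `y ∈ C`. -/
def pClass (C : ConjClasses (Dˣ ⧸ N)) : Set Dˣ := ⋃ y ∈ C.carrier, pElem N y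

/-- `ℕ_C`, the intersection of the `ℕ_y` for `y ∈ C`. -/
def nClass (C : ConjClasses (Dˣ ⧸ N)) : Set Dˣ := ⋂ y ∈ C.carrier, nElem N y

/-- `U_C = {n ∈ N : n, n⁻¹ ∈ ℕ_C}`. -/
def uClass (C : ConjClasses (Dˣ ⧸ N)) : Set Dˣ :=
  {n | n ∈ N ∧ n ∈ nClass N C ∧ n⁻¹ ∈ nClass N C}

/-- `𝕄_C = ℕ_C \ U_C`. -/
def mClass (C : ConjClasses (Dˣ ⧸ N)) : Set Dˣ := nClass N C \ uClass N C

/-- `Dˣ` satisfies the `U`-Hypothesis with respect to `S`: the set `S` is a nonempty normal subset of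
`Dˣ`, properly contained in `N`, with `±1 ∈ S` and `S² = S`, and for all `n ∈ N \ S` one has
`n + 1 ∈ S` and `n - 1 ∈ N`. -/
structure UHypothesis (S : Set Dˣ) : Prop where
  nonempty : S.Nonempty
  normal : ∀ g : Dˣ, ∀ s ∈ S, g⁻¹ * s * g ∈ S
  ssubset : S ⊂ (N : Set Dˣ)
  one_mem : 1 ∈ S
  neg_one_mem : -1 ∈ S
  mul_self : S * S = S
  add_one : ∀ n ∈ (N : Set Dˣ) \ S, ∃ s ∈ S, (n : D) + 1 = (s : D)
  sub_one : ∀ n ∈ (N : Set Dˣ) \ S, ∃ m ∈ N, (n : D) - 1 = (m : D)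

/-- The conjugacy classes `A*`, `B*` chosen when `diam(Δ) > 4`: classes of nontrivial elements such that
`Dˣ` satisfies the `U`-Hypothesis with respect to `ℕ_B`, and for each `b ∈ ℙ_B` there is `a ∈ ℙ_A`
with `d(a*, b*) > 4` and `N(b) ⊇ N(a)`. -/
structure IsDiamPair (A B : ConjClasses (Dˣ ⧸ N)) : Prop where
  left_ne : A ≠ 1
  right_ne : B ≠ 1
  uHypothesis : UHypothesis N (nClass N B)
  exists_far : ∀ b ∈ pClass N B, ∃ a ∈ pClass N A,
    (∃ (ha : (a : Dˣ ⧸ N) ≠ 1) (hb : (b : Dˣ ⧸ N) ≠ 1),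
      4 < (commutingGraph (Dˣ ⧸ N)).edist ⟨(a : Dˣ ⧸ N), ha⟩ ⟨(b : Dˣ ⧸ N), hb⟩) ∧
    nSet N a ⊆ nSet N b

/-- The conjugacy class `C*` chosen when `Δ` is balanced: a class of nontrivial elements such that `Dˣ`
satisfies the `U`-Hypothesis with respect to `ℕ_C`, and either `𝕆_x = ∅` for some `x ≠ 1`, or for each
`m ∈ 𝕄_C` there is `z ∈ C` with `m ∈ N(z₁)` for all `z₁ ∈ 𝕆_z`. -/
structure IsBalancedClass (C : ConjClasses (Dˣ ⧸ N)) : Prop where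
  ne : C ≠ 1
  uHypothesis : UHypothesis N (nClass N C)
  empty_or : (∃ x : Dˣ ⧸ N, x ≠ 1 ∧ oElem N x = ∅) ∨
    (∀ m ∈ mClass N C, ∃ z ∈ C.carrier, ∀ z₁ ∈ oElem N z, m ∈ nSet N z₁)

/-- `K̂ = {a ∈ 𝕆U \ N : N(a) ⊇ 𝕄}`, where `𝕄 = 𝕄_X` and `U = U_X`. -/
def kHat (F : Type*) [Field F] [Algebra F D] (X : ConjClasses (Dˣ ⧸ N)) : Set Dˣ :=
  {a | a ∈ (normOne F * uClass N X) \ (N : Set Dˣ) ∧ mClass N X ⊆ nSet N a}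

end Sets

end DivGroup

/-! Write `a*` for the image of `a` in the finite simple quotient, with `0* = 0`. Everything rests
on one observation: if `n ∈ N` then `(d + n)*` commutes with `d*`, because `d + n = n(n⁻¹d + 1)`.
Additive relations modulo `N` therefore become short paths in the commuting graph.

If `x`, `y` are far apart (distance above 4, or above 3 together with the distances to `x⁻¹y`), no
such short path exists. This makes `N(a)`, `N(b)` comparable for all `a`, `b` over `x`, `y`, and it
controls `n - 1` for those `n` that lie in neither set (`goodPair_of_far4`, `goodPair_of_far3`).
Comparability orients the pair, and the class of the dominated side then satisfies the
`U`-Hypothesis (`uHypothesis_of_dom`).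

The `U`-Hypothesis for `S` is valuation theory in disguise. The inverses of `S` generate a ring
meeting `N` exactly in `S⁻¹`, which cuts out a valuation ring of the center. Composing its valuation
with the norm `D → F` gives a valuation `v` of `D`: Wedderburn's factorization writes the norm of
`n` as a product of conjugates of `n`, so `S` consists of the `n ∈ N` with `v n ≥ 1`
(`UHypothesis.exists_valuation`).

Finally `1 + d ∈ N` whenever `v d < 1` (`starHom_one_add_of_lt_one`). Otherwise simplicity and
nonabelianness force congruence subgroups of every level `v(p)^(2^k)` to surject onto the quotient,
while a Hales-Jewett argument shows that a deep enough one lies in `N`. Elements of `𝕆U` have value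
`1` and elements `m` of `𝕄` have value above `1`, so `a + m = m(1 + m⁻¹a)` lies in `N`; this is the
description of `K̂`. Elements of `𝕆_x` also have value `1`, which gives the last condition in the
balanced case. -/

namespace DivGroup

open Polynomial

/-! ### Wedderburn factorization and norms as products of conjugates -/

section Wedderburn

variable {F D : Type*} [Field F] [DivisionRing D] [Algebra F D]

/-- Evaluation of a product of polynomials over a division ring. -/
theorem eval_mul_eq_eval_conj_mul (g p : D[X]) (d : D) (h : p.eval d ≠ 0) :
    (g * p).eval d = g.eval (p.eval d * d * (p.eval d)⁻¹) * p.eval d := by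
  induction g using Polynomial.induction_on' with
  | add g₁ g₂ h₁ h₂ => rw [add_mul, eval_add, eval_add, h₁, h₂, add_mul]
  | monomial n c =>
    have key : ∀ n : ℕ, (p.eval d * d * (p.eval d)⁻¹) ^ n * p.eval d = p.eval d * d ^ n := by
      intro n
      induction n with
      | zero => simp
      | succ n ih =>
        rw [pow_succ, mul_assoc, inv_mul_cancel_right₀ h, ← mul_assoc, ih, pow_succ, mul_assoc]
    rw [← C_mul_X_pow_eq_monomial, mul_assoc, X_pow_mul, ← mul_assoc, eval_mul_X_pow, eval_C_mul,
      eval_C_mul, eval_X_pow, mul_assoc, mul_assoc, key]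

/-- The remainder theorem over a noncommutative ring. -/
theorem exists_eq_mul_X_sub_C_of_eval_eq_zero (g : D[X]) (e : D) (h : g.eval e = 0) :
    ∃ q : D[X], g = q * (X - C e) := by
  have main : ∀ g : D[X], ∃ q : D[X], g = q * (X - C e) + C (g.eval e) := by
    intro g
    induction g using Polynomial.induction_on' with
    | add g₁ g₂ h₁ h₂ =>
      obtain ⟨q₁, hq₁⟩ := h₁
      obtain ⟨q₂, hq₂⟩ := h₂
      refine ⟨q₁ + q₂, ?_⟩
      rw [eval_add, C_add, add_mul]
      nth_rewrite 1 [hq₁, hq₂]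
      abel
    | monomial n c =>
      have hc : Commute (X : D[X]) (C e) := commute_X _
      have := hc.geom_sum₂_mul n
      refine ⟨C c * ∑ i ∈ Finset.range n, X ^ i * (C e) ^ (n - 1 - i), ?_⟩
      rw [mul_assoc, this, ← C_mul_X_pow_eq_monomial, eval_C_mul, eval_X_pow, C_mul, C_pow, mul_sub,
        sub_add_cancel]
  obtain ⟨q, hq⟩ := main g
  rw [h, C_0, add_zero] at hq
  exact ⟨q, hq⟩

variable [Algebra.IsCentral F D]

/-- A nonzero polynomial vanishing on a conjugacy class has at least the degree of the minimal
polynomial. -/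
theorem natDegree_minpoly_le_of_eval_conj_eq_zero (a : D) (p : D[X]) (hp : p ≠ 0)
    (h : ∀ u : Dˣ, p.eval (u * a * ↑u⁻¹) = 0) : (minpoly F a).natDegree ≤ p.natDegree := by
  classical
  let P : ℕ → Prop := fun n => ∃ p : D[X], p ≠ 0 ∧ (∀ u : Dˣ, p.eval (u * a * ↑u⁻¹) = 0) ∧
    p.natDegree = n
  have hP : ∃ n, P n := ⟨_, p, hp, h, rfl⟩
  refine le_trans ?_ (Nat.find_min' hP ⟨p, hp, h, rfl⟩)
  obtain ⟨r, hr0, hr, hrn⟩ := Nat.find_spec hP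
  rw [← hrn]
  have hlc : r.leadingCoeff ≠ 0 := leadingCoeff_ne_zero.mpr hr0
  set q : D[X] := C r.leadingCoeff⁻¹ * r with hq
  have hqm : q.Monic := by
    rw [Monic, hq, leadingCoeff_mul, leadingCoeff_C, inv_mul_cancel₀ hlc]
  have hqdeg : q.natDegree = r.natDegree := by
    rw [hq, natDegree_C_mul (inv_ne_zero hlc)]
  have hqv : ∀ u : Dˣ, q.eval (u * a * ↑u⁻¹) = 0 := fun u => by
    rw [hq, eval_C_mul, hr u, mul_zero]
  -- Conjugating the coefficients of `q` gives another monic polynomial of the same degree vanishing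
  -- on the class. The difference has smaller degree, so minimality kills it, and the coefficients
  -- of `q` are central.
  have hconj : ∀ u : Dˣ, q.map (MulSemiringAction.toRingHom (ConjAct Dˣ) D (ConjAct.toConjAct u))
      = q := by
    intro u
    set φ := MulSemiringAction.toRingHom (ConjAct Dˣ) D (ConjAct.toConjAct u) with hφ
    have hφ' : ∀ x : D, φ x = u * x * ↑u⁻¹ := fun x => by
      simp [hφ, ConjAct.units_smul_def]
    by_contra hne
    have hsub : q.map φ - q ≠ 0 := sub_ne_zero.mpr hne
    have hlt : (q.map φ - q).natDegree < q.natDegree := by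
      have := degree_sub_lt_left (p := q.map φ) (q := q) (by rw [hqm.degree_map])
        (hqm.map φ).ne_zero (by rw [(hqm.map φ).leadingCoeff, hqm.leadingCoeff])
      rw [hqm.degree_map] at this
      exact natDegree_lt_natDegree hsub this
    refine Nat.find_min hP (m := (q.map φ - q).natDegree) (by rw [← hrn, ← hqdeg]; exact hlt)
      ⟨_, hsub, fun v => ?_, rfl⟩
    have h1 : (v : D) * a * ↑v⁻¹ = φ (((u⁻¹ * v : Dˣ) : D) * a * ↑(u⁻¹ * v)⁻¹) := by
      rw [hφ']
      simp [mul_assoc]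
    rw [eval_sub, hqv v, sub_zero, h1, eval_map, eval₂_hom, hqv, map_zero]
  have hcent : ∀ n, q.coeff n ∈ (algebraMap F D).range := by
    intro n
    have : q.coeff n ∈ Subalgebra.center F D := by
      rw [Subalgebra.mem_center_iff]
      intro b
      by_cases hb : b = 0
      · simp [hb]
      · have h2 := congrArg (fun s => s.coeff n) (hconj (Units.mk0 b hb))
        simp only [coeff_map, MulSemiringAction.toRingHom_apply, ConjAct.units_smul_def,
          ConjAct.ofConjAct_toConjAct, Units.val_mk0, Units.val_inv_eq_inv_val] at h2
        rw [← eq_mul_inv_iff_mul_eq₀ (inv_ne_zero hb), inv_inv] at h2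
        exact h2
    rw [Algebra.IsCentral.center_eq_bot] at this
    exact Algebra.mem_bot.mp this
  obtain ⟨s, hs⟩ := (mem_lifts q).mp ((lifts_iff_coeff_lifts q).mpr hcent)
  have hs0 : s ≠ 0 := by
    rintro rfl
    exact hqm.ne_zero (by rw [← hs, Polynomial.map_zero])
  have hsa : aeval a s = 0 := by
    have := hqv 1
    rw [← hs] at this
    simpa [eval_map, aeval_def] using this
  calc (minpoly F a).natDegree ≤ s.natDegree := natDegree_le_of_dvd (minpoly.dvd F a hsa) hs0
    _ = r.natDegree := by rw [← hqdeg, ← hs, natDegree_map]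

/-- Wedderburn's factorization theorem: the minimal polynomial of `a` is a product of linear factors
`X - x` with `x` conjugate to `a`. -/
theorem exists_list_conj_minpoly_eq_prod [FiniteDimensional F D] (a : Dˣ) :
    ∃ l : List Dˣ, (∀ x ∈ l, ∃ g : Dˣ, x = g * a * g⁻¹) ∧ l.length = (minpoly F (a : D)).natDegree ∧
      (minpoly F (a : D)).map (algebraMap F D) = (l.map fun x : Dˣ => (X - C (x : D))).prod := by
  set f := minpoly F (a : D) with hf
  have hint : IsIntegral F (a : D) := Algebra.IsIntegral.isIntegral _
  have hfm : (f.map (algebraMap F D)).Monic := (minpoly.monic hint).map _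
  have hfv : ∀ u : Dˣ, (f.map (algebraMap F D)).eval (u * (a : D) * ↑u⁻¹) = 0 := by
    intro u
    have h1 : minpoly F ((u : D) * a * ↑u⁻¹) = f := by
      have := minpoly.algEquiv_eq (MulSemiringAction.toAlgEquiv F D (ConjAct.toConjAct u)) (a : D)
      simpa [ConjAct.units_smul_def] using this
    have := minpoly.aeval F ((u : D) * a * ↑u⁻¹)
    rw [h1] at this
    simpa [eval_map, aeval_def] using this
  have hmon : ∀ l : List Dˣ, (l.map fun x : Dˣ => (X - C (x : D))).prod.Monic ∧
      (l.map fun x : Dˣ => (X - C (x : D))).prod.natDegree = l.length := by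
    intro l
    induction l with
    | nil => simp
    | cons x l ih =>
      rw [List.map_cons, List.prod_cons]
      refine ⟨(monic_X_sub_C _).mul ih.1, ?_⟩
      rw [(monic_X_sub_C (x : D)).natDegree_mul ih.1, natDegree_X_sub_C, ih.2, List.length_cons,
        add_comm]
  have step : ∀ k ≤ f.natDegree, ∃ l : List Dˣ, (∀ x ∈ l, ∃ g : Dˣ, x = g * a * g⁻¹) ∧
      l.length = k ∧ ∃ g : D[X],
        f.map (algebraMap F D) = g * (l.map fun x : Dˣ => (X - C (x : D))).prod := by
    intro k
    induction k with
    | zero => exact fun _ => ⟨[], by simp, rfl, f.map (algebraMap F D), by simp⟩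
    | succ k ih =>
      intro hk
      obtain ⟨l, hl, hlen, g, hg⟩ := ih (by omega)
      set p := (l.map fun x : Dˣ => (X - C (x : D))).prod with hp
      -- While `p` has degree below that of `f`, it misses some conjugate of `a`. The evaluation
      -- formula turns this conjugate into a further one that is a root of the cofactor `g`, so
      -- another linear factor splits off.
      obtain ⟨u, hu⟩ : ∃ u : Dˣ, p.eval (u * (a : D) * ↑u⁻¹) ≠ 0 := by
        by_contra! hcon
        have := natDegree_minpoly_le_of_eval_conj_eq_zero (F := F) (a : D) p (hmon l).1.ne_zero hcon
        rw [(hmon l).2, ← hf] at this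
        omega
      have h0 := hfv u
      rw [hg, eval_mul_eq_eval_conj_mul _ _ _ hu] at h0
      have h1 := (mul_eq_zero.mp h0).resolve_right hu
      obtain ⟨q, hq⟩ := exists_eq_mul_X_sub_C_of_eval_eq_zero _ _ h1
      refine ⟨(Units.mk0 _ hu * u) * a * (Units.mk0 _ hu * u)⁻¹ :: l, ?_, by simp [hlen], q, ?_⟩
      · intro x hx
        rcases List.mem_cons.mp hx with rfl | hx
        · exact ⟨_, rfl⟩
        · exact hl x hx
      · rw [List.map_cons, List.prod_cons, ← mul_assoc, hg, ← hp]
        congr 1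
        rw [hq]
        congr 3
        simp [mul_assoc]
  obtain ⟨l, hl, hlen, g, hg⟩ := step _ le_rfl
  refine ⟨l, hl, hlen, ?_⟩
  have hgm : g.Monic := (hmon l).1.of_mul_monic_right (by rw [← hg]; exact hfm)
  have hdeg : g.natDegree = 0 := by
    have := congrArg natDegree hg
    rw [hgm.natDegree_mul (hmon l).1, (hmon l).2, hlen, natDegree_map] at this
    omega
  rw [hg, hgm.natDegree_eq_zero.mp hdeg, one_mul]

-- `D` is a vector space of some dimension `m` over `F(a)`, on which left multiplication by `a` is a
-- scalar. Its determinant over `F` is thus the `m`-th power of the norm of `a` from `F(a)` to `F`.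
omit [Algebra.IsCentral F D] in
theorem norm_eq_coeff_zero_minpoly_pow [FiniteDimensional F D] (a : D) :
    ∃ m : ℕ, m ≠ 0 ∧ Algebra.norm F a =
      ((-1) ^ (minpoly F a).natDegree * (minpoly F a).coeff 0) ^ m := by
  have hint : IsIntegral F a := Algebra.IsIntegral.isIntegral _
  have : Fact (Irreducible (minpoly F a)) := ⟨minpoly.irreducible hint⟩
  have hm := minpoly.monic hint
  let i : AdjoinRoot (minpoly F a) →+* D := Ideal.Quotient.lift _ (aeval a : F[X] →ₐ[F] D).toRingHom
    (fun x hx => by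
      obtain ⟨y, rfl⟩ := Ideal.mem_span_singleton.mp hx
      change aeval a (minpoly F a * y) = 0
      rw [map_mul, minpoly.aeval, zero_mul])
  have hi : ∀ p, i (AdjoinRoot.mk _ p) = aeval a p := fun p => rfl
  let _ : Module (AdjoinRoot (minpoly F a)) D := Module.compHom D i
  have hsm : ∀ (x : AdjoinRoot (minpoly F a)) (d : D), x • d = i x * d := fun _ _ => rfl
  have : IsScalarTower F (AdjoinRoot (minpoly F a)) D := ⟨fun c x d => by
    obtain ⟨p, rfl⟩ := AdjoinRoot.mk_surjective x
    rw [AdjoinRoot.smul_mk, hsm, hsm, hi, hi, map_smul, smul_mul_assoc]⟩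
  have : FiniteDimensional (AdjoinRoot (minpoly F a)) D := FiniteDimensional.right F _ _
  refine ⟨Module.finrank (AdjoinRoot (minpoly F a)) D, Module.finrank_pos.ne', ?_⟩
  have h1 : Algebra.lmul F D a = ((AdjoinRoot.root (minpoly F a)) •
      (LinearMap.id : D →ₗ[AdjoinRoot (minpoly F a)] D)).restrictScalars F := by
    ext d
    change a * d = i (AdjoinRoot.mk _ X) * d
    rw [hi, aeval_X]
  rw [Algebra.norm_apply, h1, LinearMap.det_restrictScalars, LinearMap.det_smul, LinearMap.det_id,
    mul_one, map_pow]
  have h2 := Algebra.PowerBasis.norm_gen_eq_coeff_zero_minpoly (AdjoinRoot.powerBasis' hm)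
  rw [AdjoinRoot.powerBasis'_gen, AdjoinRoot.powerBasis'_dim, AdjoinRoot.minpoly_root hm.ne_zero, hm.leadingCoeff] at h2
  rw [h2]
  simp

/-- The norm of `a` is a product of conjugates of `a`. -/
theorem exists_list_conj_norm_eq_prod [FiniteDimensional F D] (a : Dˣ) :
    ∃ l : List Dˣ, l ≠ [] ∧ (∀ x ∈ l, ∃ g : Dˣ, x = g * a * g⁻¹) ∧
      algebraMap F D (Algebra.norm F (a : D)) = ((l.prod : Dˣ) : D) := by
  obtain ⟨l, hl, hlen, hf⟩ := exists_list_conj_minpoly_eq_prod (F := F) a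
  obtain ⟨m, hm, hn⟩ := norm_eq_coeff_zero_minpoly_pow (F := F) (a : D)
  have hint : IsIntegral F (a : D) := Algebra.IsIntegral.isIntegral _
  have hpos := minpoly.natDegree_pos hint
  have h0 : ∀ l : List Dˣ, (l.map fun x : Dˣ => (X - C (x : D))).prod.coeff 0 =
      (-1) ^ l.length * ((l.prod : Dˣ) : D) := by
    intro l
    induction l with
    | nil => simp
    | cons x l ih =>
      rw [List.map_cons, List.prod_cons, mul_coeff_zero, ih, List.length_cons, List.prod_cons,
        pow_succ, Units.val_mul, coeff_sub, coeff_X_zero, coeff_C_zero, zero_sub, neg_mul,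
        ← mul_assoc, ← ((Commute.neg_one_left (x : D)).pow_left l.length).eq]
      simp [mul_assoc]
  have h1 : algebraMap F D ((-1) ^ (minpoly F (a : D)).natDegree * (minpoly F (a : D)).coeff 0) =
      ((l.prod : Dˣ) : D) := by
    rw [map_mul, ← coeff_map, hf, h0, hlen, map_pow, map_neg, map_one, ← mul_assoc, ← pow_add,
      Even.neg_one_pow ⟨_, rfl⟩, one_mul]
  refine ⟨(List.replicate m l).flatten, ?_, ?_, ?_⟩
  · intro h
    rw [List.flatten_eq_nil_iff] at h
    have := h l (List.mem_replicate.mpr ⟨hm, rfl⟩)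
    rw [this] at hlen
    simp at hlen
    omega
  · intro x hx
    obtain ⟨l', hl', hx⟩ := List.mem_flatten.mp hx
    rw [(List.mem_replicate.mp hl').2] at hx
    exact hl x hx
  · rw [hn, map_pow, h1, List.prod_flatten, List.map_replicate, List.prod_replicate, Units.val_pow_eq_pow_val]

end Wedderburn

/-! ### Reduced norm one implies norm one -/

section ReducedNorm

/-- The matrix algebra is a sum of `n` column spaces, and `A` acts on each of them separately. The
transpose exposes the columns as a product. -/
theorem det_mulLeft_matrix {E : Type*} [Field E] {n : ℕ} (A : Matrix (Fin n) (Fin n) E) :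
    LinearMap.det (Algebra.lmul E (Matrix (Fin n) (Fin n) E) A) = A.det ^ n := by
  let e : Matrix (Fin n) (Fin n) E ≃ₗ[E] (Fin n → Fin n → E) := Matrix.transposeLinearEquiv _ _ E E
  rw [← LinearMap.det_conj _ e]
  have : (e ∘ₗ (Algebra.lmul E (Matrix (Fin n) (Fin n) E) A) ∘ₗ e.symm : _ →ₗ[E] _) =
      LinearMap.pi (fun i : Fin n => (Matrix.toLin' A).comp (LinearMap.proj i)) := by
    refine LinearMap.ext fun M => ?_
    ext k l
    change (A * Matrix.transpose (Matrix.of M)) l k = (A.mulVec (M k)) l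
    simp [Matrix.mul_apply, Matrix.mulVec, dotProduct]
  rw [this, LinearMap.det_pi]
  simp

theorem norm_eq_one_of_isReducedNorm {F D : Type*} [Field F] [DivisionRing D] [Algebra F D]
    [FiniteDimensional F D] {a : D} (h : IsReducedNorm F a 1) : Algebra.norm F a = 1 := by
  obtain ⟨n, φ, hφ⟩ := h
  rw [map_one] at hφ
  apply (algebraMap F (AlgebraicClosure F)).injective
  rw [map_one, Algebra.norm_apply, ← LinearMap.det_baseChange]
  have h1 : (Algebra.lmul F D a).baseChange (AlgebraicClosure F) =
      Algebra.lmul (AlgebraicClosure F) _ ((1 : AlgebraicClosure F) ⊗ₜ[F] a) := by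
    ext d
    simp
  rw [h1, ← LinearMap.det_conj _ φ.toLinearEquiv]
  have h2 : (φ.toLinearEquiv ∘ₗ (Algebra.lmul (AlgebraicClosure F) (AlgebraicClosure F ⊗[F] D)
      ((1 : AlgebraicClosure F) ⊗ₜ[F] a)) ∘ₗ φ.toLinearEquiv.symm : _ →ₗ[_] _) =
      Algebra.lmul (AlgebraicClosure F) _ (φ ((1 : AlgebraicClosure F) ⊗ₜ[F] a)) := by
    refine LinearMap.ext fun M => ?_
    simp
  rw [h2, det_mulLeft_matrix, hφ, one_pow]

end ReducedNorm

end DivGroup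

namespace DivGroup

/-! ### Distances in the commuting graph, with a zero adjoined to the group -/

section Far

/-- No path of length at most `3` from `x` to `y` in the commuting graph. -/
def Far3 {W : Type*} [GroupWithZero W] (x y : W) : Prop :=
  ∀ p q : W, p ≠ 0 → p ≠ 1 → q ≠ 0 → q ≠ 1 → Commute x p → Commute p q → Commute q y → False

/-- No path of length at most `4` from `x` to `y` in the commuting graph. -/
def Far4 {W : Type*} [GroupWithZero W] (x y : W) : Prop :=
  ∀ p q r : W, p ≠ 0 → p ≠ 1 → q ≠ 0 → q ≠ 1 → r ≠ 0 → r ≠ 1 →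
    Commute x p → Commute p q → Commute q r → Commute r y → False

theorem edist_le_one_of_commute {X : Type*} [Group X] {x y : {x : X // x ≠ 1}}
    (h : Commute (x : X) y) : (commutingGraph X).edist x y ≤ 1 := by
  by_cases hxy : x = y
  · simp [hxy]
  · have hadj : (commutingGraph X).Adj x y := ⟨hxy, h⟩
    simpa using SimpleGraph.edist_le hadj.toWalk

theorem far3_of_lt_edist {X : Type*} [Group X] {x y : {x : X // x ≠ 1}}
    (h : 3 < (commutingGraph X).edist x y) : Far3 ((x : X) : WithZero X) ((y : X) : WithZero X) := by
  intro p q hp hp1 hq hq1 h1 h2 h3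
  obtain ⟨p, rfl⟩ := WithZero.ne_zero_iff_exists.mp hp
  obtain ⟨q, rfl⟩ := WithZero.ne_zero_iff_exists.mp hq
  have hp' : p ≠ 1 := fun h => hp1 (by rw [h, WithZero.coe_one])
  have hq' : q ≠ 1 := fun h => hq1 (by rw [h, WithZero.coe_one])
  simp only [commute_iff_eq, ← WithZero.coe_mul, WithZero.coe_inj] at h1 h2 h3
  have e1 := edist_le_one_of_commute (x := x) (y := ⟨p, hp'⟩) h1
  have e2 := edist_le_one_of_commute (x := ⟨p, hp'⟩) (y := ⟨q, hq'⟩) h2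
  have e3 := edist_le_one_of_commute (x := ⟨q, hq'⟩) (y := y) h3
  refine absurd h (not_lt.mpr ?_)
  calc (commutingGraph X).edist x y
      ≤ (commutingGraph X).edist x ⟨p, hp'⟩ + (commutingGraph X).edist ⟨p, hp'⟩ y :=
        SimpleGraph.edist_triangle
    _ ≤ 1 + ((commutingGraph X).edist ⟨p, hp'⟩ ⟨q, hq'⟩ + (commutingGraph X).edist ⟨q, hq'⟩ y) :=
        add_le_add e1 SimpleGraph.edist_triangle
    _ ≤ 1 + (1 + 1) := by gcongr
    _ = 3 := by norm_num

theorem far4_of_lt_edist {X : Type*} [Group X] {x y : {x : X // x ≠ 1}}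
    (h : 4 < (commutingGraph X).edist x y) : Far4 ((x : X) : WithZero X) ((y : X) : WithZero X) := by
  intro p q r hp hp1 hq hq1 hr hr1 h1 h2 h3 h4
  obtain ⟨p, rfl⟩ := WithZero.ne_zero_iff_exists.mp hp
  have hp' : p ≠ 1 := fun h => hp1 (by rw [h, WithZero.coe_one])
  have h3' : 3 < (commutingGraph X).edist ⟨p, hp'⟩ y := by
    by_contra hcon
    simp only [commute_iff_eq, ← WithZero.coe_mul, WithZero.coe_inj] at h1
    refine absurd h (not_lt.mpr ?_)
    calc (commutingGraph X).edist x y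
        ≤ (commutingGraph X).edist x ⟨p, hp'⟩ + (commutingGraph X).edist ⟨p, hp'⟩ y :=
          SimpleGraph.edist_triangle
      _ ≤ 1 + 3 := add_le_add (edist_le_one_of_commute h1) (not_lt.mp hcon)
      _ = 4 := by norm_num
  exact far3_of_lt_edist h3' q r hq hq1 hr hr1 h2 h3 h4

theorem edist_conj {X : Type*} [Group X] (g : X) {x y : X} (hx : x ≠ 1) (hy : y ≠ 1)
    (hx' : g * x * g⁻¹ ≠ 1) (hy' : g * y * g⁻¹ ≠ 1) :
    (commutingGraph X).edist ⟨x, hx⟩ ⟨y, hy⟩ ≤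
      (commutingGraph X).edist ⟨g * x * g⁻¹, hx'⟩ ⟨g * y * g⁻¹, hy'⟩ := by
  let f : commutingGraph X →g commutingGraph X :=
    { toFun := fun z => ⟨g⁻¹ * z * g, fun h => z.2 (by
        have := congrArg (fun t => g * t * g⁻¹) h
        simpa [mul_assoc] using this)⟩
      map_rel' := fun {a b} h => by
        refine ⟨fun hab => h.1 ?_, ?_⟩
        · simpa [Subtype.ext_iff] using hab
        · have h2 : (a : X) * b = b * a := h.2
          change g⁻¹ * a * g * (g⁻¹ * b * g) = g⁻¹ * b * g * (g⁻¹ * a * g)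
          calc g⁻¹ * a * g * (g⁻¹ * b * g) = g⁻¹ * (a * b) * g := by group
            _ = g⁻¹ * (b * a) * g := by rw [h2]
            _ = _ := by group }
  by_cases htop : (commutingGraph X).edist ⟨g * x * g⁻¹, hx'⟩ ⟨g * y * g⁻¹, hy'⟩ = ⊤
  · rw [htop]; exact le_top
  · obtain ⟨w, hw⟩ := SimpleGraph.exists_walk_of_edist_ne_top htop
    rw [← hw]
    have h1 : f ⟨g * x * g⁻¹, hx'⟩ = ⟨x, hx⟩ := Subtype.ext (by simp [f, mul_assoc])
    have h2 : f ⟨g * y * g⁻¹, hy'⟩ = ⟨y, hy⟩ := Subtype.ext (by simp [f, mul_assoc])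
    have := SimpleGraph.edist_le (w.map f)
    rwa [SimpleGraph.Walk.length_map, h1, h2] at this

end Far

/-! ### From additive relations modulo `N` to commuting paths -/

section Star

variable {D : Type*} [DivisionRing D] (N : Subgroup Dˣ) [N.Normal]

open Classical in
/-- The quotient map `Dˣ → Dˣ ⧸ N`, extended by `0 ↦ 0`. -/
noncomputable def starHom : D →*₀ WithZero (Dˣ ⧸ N) where
  toFun d := if h : d = 0 then 0 else ((Units.mk0 d h : Dˣ) : Dˣ ⧸ N)
  map_zero' := by simp
  map_one' := by
    rw [dif_neg one_ne_zero, Units.mk0_one, QuotientGroup.mk_one, WithZero.coe_one]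
  map_mul' a b := by
    by_cases ha : a = 0
    · simp [ha]
    by_cases hb : b = 0
    · simp [hb]
    rw [dif_neg (mul_ne_zero ha hb), dif_neg ha, dif_neg hb, Units.mk0_mul, QuotientGroup.mk_mul,
      WithZero.coe_mul]

theorem starHom_coe (a : Dˣ) : starHom N (a : D) = ((a : Dˣ ⧸ N) : WithZero (Dˣ ⧸ N)) := by
  exact (dif_neg a.ne_zero).trans (by rw [Units.mk0_val])

theorem starHom_coe_eq_one {a : Dˣ} : starHom N (a : D) = 1 ↔ a ∈ N := by
  rw [starHom_coe, ← WithZero.coe_one, WithZero.coe_inj, QuotientGroup.eq_one_iff]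

theorem starHom_eq_one_iff {d : D} : starHom N d = 1 ↔ ∃ m ∈ N, d = (m : D) := by
  constructor
  · intro h
    have hd : d ≠ 0 := by rintro rfl; simp at h
    exact ⟨Units.mk0 d hd, (starHom_coe_eq_one N).mp h, rfl⟩
  · rintro ⟨m, hm, rfl⟩
    exact (starHom_coe_eq_one N).mpr hm

theorem mem_nSet_iff {a n : Dˣ} :
    n ∈ nSet N a ↔ starHom N (n : D) = 1 ∧ starHom N ((a : D) + n) = 1 := by
  rw [starHom_coe_eq_one, starHom_eq_one_iff]
  rfl

variable {N}

theorem commute_starHom_add {d n : D} (hn : starHom N n = 1) :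
    Commute (starHom N (d + n)) (starHom N d) := by
  have hn0 : n ≠ 0 := by rintro rfl; simp at hn
  have h1 : d + n = n * (n⁻¹ * d + 1) := by rw [mul_add, mul_inv_cancel_left₀ hn0, mul_one]
  have h2 : starHom N d = starHom N (n⁻¹ * d) := by rw [map_mul, map_inv₀, hn, inv_one, one_mul]
  rw [h1, h2, map_mul, hn, one_mul]
  exact ((Commute.refl _).add_left (Commute.one_left _)).map (starHom N)

theorem starHom_neg (hneg : starHom N (-1 : D) = 1) (d : D) : starHom N (-d) = starHom N d := by
  rw [← neg_one_mul, map_mul, hneg, one_mul]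

/-- The set `N(a)`, as a set of elements of `D`. -/
def nD (N : Subgroup Dˣ) [N.Normal] (a : D) : Set D := {n | starHom N n = 1 ∧ starHom N (a + n) = 1}

/-- Since `ab - 1 = (a - 1)(t + 1)` with `t = (a - 1)⁻¹a(b - 1)` and `t* = (a - 1)*⁻¹a*`, failure
would give the path `a*`, `t*`, `(ab - 1)*`, `(ab)*`. The assumption `(a - 1)* ≠ a*` makes `t*` a
vertex. -/
theorem starHom_mul_sub_one {a b : D} (hneg : starHom N (-1 : D) = 1)
    (hfar : Far3 (starHom N a) (starHom N (a * b))) (ha1 : starHom N a ≠ 1) (ha0 : a ≠ 0)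
    (hab : starHom N (a * b) ≠ 1) (h1 : starHom N (a - 1) ≠ starHom N a)
    (h2 : starHom N (b - 1) = 1) : starHom N (a * b - 1) = 1 := by
  by_contra hne
  have hσ0 : ∀ {d : D}, d ≠ 0 → starHom N d ≠ 0 := fun h => (map_ne_zero _).mpr h
  have hx := hσ0 ha0
  have ha10 : a - 1 ≠ 0 := fun h => ha1 (by rw [sub_eq_zero.mp h, map_one])
  have hab0 : a * b - 1 ≠ 0 := fun h => hab (by rw [sub_eq_zero.mp h, map_one])
  have hp := hσ0 ha10
  have hσt : starHom N ((a - 1)⁻¹ * (a * (b - 1))) = (starHom N (a - 1))⁻¹ * starHom N a := by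
    rw [map_mul, map_inv₀, map_mul, h2, mul_one]
  have hpx : Commute (starHom N (a - 1)) (starHom N a) := by
    rw [sub_eq_add_neg]
    exact commute_starHom_add hneg
  have hdec : a * b - 1 = (a - 1) * ((a - 1)⁻¹ * (a * (b - 1)) + 1) := by
    rw [mul_add, mul_inv_cancel_left₀ ha10, mul_one, mul_sub, mul_one]
    abel
  refine hfar ((starHom N (a - 1))⁻¹ * starHom N a) (starHom N (a * b - 1))
    (mul_ne_zero (inv_ne_zero hp) hx) ?_ (hσ0 hab0) hne ?_ ?_ ?_
  · intro h
    exact h1 ((inv_mul_eq_one₀ hp).mp h)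
  · exact (hpx.symm.inv_right₀).mul_right (Commute.refl _)
  · rw [hdec, map_mul]
    refine Commute.mul_right ?_ ?_
    · exact ((Commute.refl _).inv_left₀).mul_left hpx.symm
    · rw [← hσt]
      exact (commute_starHom_add (map_one _)).symm
  · rw [sub_eq_add_neg]
    exact commute_starHom_add hneg

/-- The two consequences of `a*` and `b*` being far apart used to verify the `U`-Hypothesis. -/
def GoodPair (N : Subgroup Dˣ) [N.Normal] (x y : WithZero (Dˣ ⧸ N)) : Prop :=
  ∀ a b : D, starHom N a = x → starHom N b = y →
    (nD N a ⊆ nD N b ∨ nD N b ⊆ nD N a) ∧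
    (starHom N (a + 1) = 1 → starHom N (b + 1) = 1 → ∀ n : D, starHom N n = 1 →
      n ∉ nD N a → n ∉ nD N b → starHom N (n - 1) = 1)

theorem GoodPair.symm {x y : WithZero (Dˣ ⧸ N)} (h : GoodPair N x y) : GoodPair N y x :=
  fun b a hb ha => ⟨(h a b ha hb).1.symm, fun h1 h2 n hn h3 h4 => (h a b ha hb).2 h2 h1 n hn h4 h3⟩

theorem add_ne_zero_of_starHom (hneg : starHom N (-1 : D) = 1) {a n : D} (ha : starHom N a ≠ 1)
    (hn : starHom N n = 1) : a + n ≠ 0 := fun h =>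
  ha (by rw [eq_neg_of_add_eq_zero_left h, starHom_neg hneg, hn])

/-- Both failures produce a path of length 4. If `s ∈ N(a) \ N(b)` and `t ∈ N(b) \ N(a)`, it is
`a*`, `(a + t)*`, `(a - b)*`, `(b + s)*`, `b*`; for the second property it is `a*`, `(a + n)*`, `(n
- 1)*`, `(b + n)*`, `b*`. -/
theorem goodPair_of_far4 (hneg : starHom N (-1 : D) = 1) {x y : WithZero (Dˣ ⧸ N)}
    (hx1 : x ≠ 1) (hy0 : y ≠ 0) (hy1 : y ≠ 1) (hfar : Far4 x y) : GoodPair N x y := by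
  rintro a b rfl rfl
  have hσ0 : ∀ {d : D}, d ≠ 0 → starHom N d ≠ 0 := fun h => (map_ne_zero _).mpr h
  have hncomm : ¬ Commute (starHom N a) (starHom N b) := fun h =>
    hfar _ _ _ hy0 hy1 hy0 hy1 hy0 hy1 h (Commute.refl _) (Commute.refl _) (Commute.refl _)
  refine ⟨?_, ?_⟩
  · by_contra! hcon
    obtain ⟨⟨s, hsa, hsb⟩, ⟨t, htb, hta⟩⟩ :=
      And.imp Set.not_subset.mp Set.not_subset.mp hcon
    have hsb' : starHom N (b + s) ≠ 1 := fun h => hsb ⟨hsa.1, h⟩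
    have hta' : starHom N (a + t) ≠ 1 := fun h => hta ⟨htb.1, h⟩
    have hab : a - b ≠ 0 := fun h => hncomm (by rw [sub_eq_zero.mp h])
    have hab1 : starHom N (a - b) ≠ 1 := fun h => hncomm (by
      have := commute_starHom_add (d := b) h
      rwa [add_sub_cancel] at this)
    refine hfar (starHom N (a + t)) (starHom N (a - b)) (starHom N (b + s))
      (hσ0 (add_ne_zero_of_starHom hneg hx1 htb.1)) hta' (hσ0 hab) hab1
      (hσ0 (add_ne_zero_of_starHom hneg hy1 hsa.1)) hsb' (commute_starHom_add htb.1).symm ?_ ?_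
      (commute_starHom_add hsa.1)
    · have h1 : a - b = (a + t) + -(b + t) := by abel
      rw [h1]
      exact (commute_starHom_add (by rw [starHom_neg hneg, htb.2])).symm
    · have h1 : a - b = -(b + s) + (a + s) := by abel
      rw [h1, ← starHom_neg hneg (b + s)]
      exact commute_starHom_add hsa.2
  · intro ha1 hb1 n hn hna hnb
    by_contra hc
    have hna' : starHom N (a + n) ≠ 1 := fun h => hna ⟨hn, h⟩
    have hnb' : starHom N (b + n) ≠ 1 := fun h => hnb ⟨hn, h⟩
    have hn1 : n - 1 ≠ 0 := fun h => hna' (by rw [sub_eq_zero.mp h, ha1])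
    refine hfar (starHom N (a + n)) (starHom N (n - 1)) (starHom N (b + n))
      (hσ0 (add_ne_zero_of_starHom hneg hx1 hn)) hna' (hσ0 hn1) hc
      (hσ0 (add_ne_zero_of_starHom hneg hy1 hn)) hnb' (commute_starHom_add hn).symm ?_ ?_
      (commute_starHom_add hn)
    · have h1 : a + n = (n - 1) + (a + 1) := by abel
      rw [h1]
      exact commute_starHom_add ha1
    · have h1 : b + n = (n - 1) + (b + 1) := by abel
      rw [h1]
      exact (commute_starHom_add hb1).symm

/-- `starHom_mul_sub_one` puts `a⁻¹nb - 1` in `N`. This element is the sum of `a⁻¹b - 1` and `a⁻¹(n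
- 1)b`, so `w = (a⁻¹b - 1)*` commutes with `x⁻¹cy`, where `x = a*`, `y = b*`, `c = (n - 1)*`. As `w`
also commutes with `x⁻¹y`, it commutes with `x⁻¹cx`; conjugating by `x` gives the claim. -/
theorem commute_starHom_sub_mul_inv (hneg : starHom N (-1 : D) = 1) {a b n : D}
    (hfar : Far3 (starHom N a)⁻¹ ((starHom N a)⁻¹ * starHom N b)) (ha0 : a ≠ 0) (hb0 : b ≠ 0)
    (ha1 : starHom N a ≠ 1) (hab : starHom N a ≠ starHom N b) (hn : starHom N n = 1)
    (hna : starHom N (a + n) ≠ 1) (hb1 : starHom N (b + 1) = 1) :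
    Commute (starHom N (a - b) * (starHom N a)⁻¹) (starHom N (n - 1)) := by
  have hx : starHom N a ≠ 0 := (map_ne_zero _).mpr ha0
  have hy : starHom N b ≠ 0 := (map_ne_zero _).mpr hb0
  have hxy : (starHom N a)⁻¹ * starHom N b ≠ 1 := fun h => hab ((inv_mul_eq_one₀ hx).mp h)
  have hσ1 : starHom N (-(a⁻¹ * n)) = (starHom N a)⁻¹ := by
    rw [starHom_neg hneg, map_mul, map_inv₀, hn, mul_one]
  have hσ2 : starHom N (-(a⁻¹ * n) * -b) = (starHom N a)⁻¹ * starHom N b := by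
    rw [map_mul, hσ1, starHom_neg hneg]
  have hn0 : n ≠ 0 := by rintro rfl; simp at hn
  have h1 : starHom N (a⁻¹ * n * b - 1) = 1 := by
    have := starHom_mul_sub_one (N := N) (a := -(a⁻¹ * n)) (b := -b) hneg
      (by rw [hσ1, hσ2]; exact hfar) (by rw [hσ1]; exact fun h => ha1 (inv_eq_one.mp h))
      (neg_ne_zero.mpr (mul_ne_zero (inv_ne_zero ha0) hn0)) (by rw [hσ2]; exact hxy) ?_ ?_
    · rwa [neg_mul_neg] at this
    · have h3 : -(a⁻¹ * n) - 1 = -(a⁻¹ * (a + n)) := by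
        rw [mul_add, inv_mul_cancel₀ ha0]; abel
      rw [hσ1, h3, starHom_neg hneg, map_mul, map_inv₀]
      intro h
      exact hna ((mul_eq_left₀ (inv_ne_zero hx)).mp h)
    · rw [← neg_add', starHom_neg hneg, hb1]
  set x := starHom N a with hxdef
  set y := starHom N b with hydef
  set c := starHom N (n - 1) with hc
  set w := starHom N (a⁻¹ * b - 1) with hw
  have hz : starHom N (a - b) = x * w := by
    rw [hw, hxdef, ← map_mul, ← starHom_neg hneg, mul_sub, mul_inv_cancel_left₀ ha0, mul_one,
      neg_sub]
  have hw1 : Commute w (x⁻¹ * y) := by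
    have : starHom N (a⁻¹ * b) = x⁻¹ * y := by rw [map_mul, map_inv₀]
    rw [← this, hw, sub_eq_add_neg]
    exact commute_starHom_add hneg
  have hw2 : Commute w (x⁻¹ * c * y) := by
    have h4 : starHom N (-(a⁻¹ * (n - 1) * b)) = x⁻¹ * c * y := by
      rw [starHom_neg hneg, map_mul, map_mul, map_inv₀]
    have h5 : a⁻¹ * b - 1 = -(a⁻¹ * (n - 1) * b) + (a⁻¹ * n * b - 1) := by noncomm_ring
    rw [← h4, hw, h5]
    exact commute_starHom_add h1
  have hw3 : Commute w (x⁻¹ * c * x) := by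
    have := hw2.mul_right hw1.inv_right₀
    rwa [mul_inv_rev, inv_inv, mul_assoc _ y, mul_inv_cancel_left₀ hy] at this
  rw [hz, commute_iff_eq]
  have := hw3.eq
  calc x * w * x⁻¹ * c = x * (w * (x⁻¹ * c * x)) * x⁻¹ := by
        simp only [mul_assoc]; rw [mul_inv_cancel₀ hx, mul_one]
    _ = x * (x⁻¹ * c * x * w) * x⁻¹ := by rw [this]
    _ = c * (x * w * x⁻¹) := by
        simp only [mul_assoc]; rw [mul_inv_cancel_left₀ hx]

/-- Incomparable `N(a)`, `N(b)` would put both `a⁻¹b - 1` and `b⁻¹a - 1` in `N`; their ratio is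
`-b⁻¹a`, forcing `a* = b*`. For the second property, applying `commute_starHom_sub_mul_inv` in both
orders shows that `c = (n - 1)*` commutes with `xy⁻¹`. With `p = (a + n)*`, conjugation by `x`
yields the forbidden path `x`, `x⁻¹px`, `x⁻¹cx`, `x⁻¹y`. -/
theorem goodPair_of_far3 (hneg : starHom N (-1 : D) = 1) {x y : WithZero (Dˣ ⧸ N)}
    (hx0 : x ≠ 0) (hx1 : x ≠ 1) (hy0 : y ≠ 0) (hy1 : y ≠ 1) (h1 : Far3 x y)
    (h2 : Far3 x (x⁻¹ * y)) (h3 : Far3 y (x⁻¹ * y)) : GoodPair N x y := by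
  rintro a b rfl rfl
  have hσ0 : ∀ {d : D}, d ≠ 0 → starHom N d ≠ 0 := fun h => (map_ne_zero _).mpr h
  have ha0 : a ≠ 0 := by rintro rfl; simp at hx0
  have hb0 : b ≠ 0 := by rintro rfl; simp at hy0
  have hne : starHom N a ≠ starHom N b := fun h =>
    h1 _ _ hy0 hy1 hy0 hy1 (by rw [h]) (Commute.refl _) (Commute.refl _)
  have f1 : Far3 (starHom N a)⁻¹ ((starHom N a)⁻¹ * starHom N b) :=
    fun p q hp hp1 hq hq1 c1 c2 c3 =>
      h2 p q hp hp1 hq hq1 (Commute.inv_left_iff₀.mp c1) c2 c3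
  have f2 : Far3 (starHom N b)⁻¹ ((starHom N b)⁻¹ * starHom N a) :=
    fun p q hp hp1 hq hq1 c1 c2 c3 =>
      h3 p q hp hp1 hq hq1 (Commute.inv_left_iff₀.mp c1) c2 (by
        have := c3.inv_right₀
        rwa [mul_inv_rev, inv_inv] at this)
  refine ⟨?_, ?_⟩
  · by_contra! hcon
    obtain ⟨⟨s, hsa, hsb⟩, ⟨t, htb, hta⟩⟩ :=
      And.imp Set.not_subset.mp Set.not_subset.mp hcon
    have key : ∀ {a b t : D}, a ≠ 0 → starHom N a ≠ 1 → starHom N a ≠ starHom N b →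
        Far3 (starHom N a)⁻¹ ((starHom N a)⁻¹ * starHom N b) → t ∈ nD N b → t ∉ nD N a →
        starHom N (a⁻¹ * b - 1) = 1 := by
      intro a b t ha0 ha1 hab hfar htb hta
      have hx : starHom N a ≠ 0 := hσ0 ha0
      have ht0 : t ≠ 0 := by rintro rfl; simpa using htb.1
      have e1 : starHom N (-(a⁻¹ * t)) = (starHom N a)⁻¹ := by
        rw [starHom_neg hneg, map_mul, map_inv₀, htb.1, mul_one]
      have e2 : -(a⁻¹ * t) * -(t⁻¹ * b) = a⁻¹ * b := by
        rw [neg_mul_neg, mul_assoc, mul_inv_cancel_left₀ ht0]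
      have e3 : starHom N (a⁻¹ * b) = (starHom N a)⁻¹ * starHom N b := by rw [map_mul, map_inv₀]
      rw [← e2]
      refine starHom_mul_sub_one hneg (by rw [e1, e2, e3]; exact hfar)
        (by rw [e1]; exact fun h => ha1 (inv_eq_one.mp h))
        (neg_ne_zero.mpr (mul_ne_zero (inv_ne_zero ha0) ht0))
        (by rw [e2, e3]; exact fun h => hab ((inv_mul_eq_one₀ hx).mp h)) ?_ ?_
      · have e4 : -(a⁻¹ * t) - 1 = -(a⁻¹ * (a + t)) := by
          rw [mul_add, inv_mul_cancel₀ ha0]; abel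
        rw [e1, e4, starHom_neg hneg, map_mul, map_inv₀]
        exact fun h => hta ⟨htb.1, (mul_eq_left₀ (inv_ne_zero hx)).mp h⟩
      · have e4 : -(t⁻¹ * b) - 1 = -(t⁻¹ * (b + t)) := by
          rw [mul_add, inv_mul_cancel₀ ht0]; abel
        rw [e4, starHom_neg hneg, map_mul, map_inv₀, htb.1, htb.2, inv_one, mul_one]
    have k1 := key ha0 hx1 hne f1 htb hta
    have k2 := key hb0 hy1 hne.symm f2 hsa hsb
    have e : b⁻¹ * a - 1 = -((b⁻¹ * a) * (a⁻¹ * b - 1)) := by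
      rw [mul_sub, mul_assoc b⁻¹, mul_inv_cancel_left₀ ha0, inv_mul_cancel₀ hb0]; noncomm_ring
    rw [e, starHom_neg hneg, map_mul, k1, mul_one, map_mul, map_inv₀] at k2
    exact hne ((inv_mul_eq_one₀ hy0).mp k2).symm
  · intro ha1 hb1 n hn hna hnb
    by_contra hc
    have hna' : starHom N (a + n) ≠ 1 := fun h => hna ⟨hn, h⟩
    have hnb' : starHom N (b + n) ≠ 1 := fun h => hnb ⟨hn, h⟩
    have hn1 : n - 1 ≠ 0 := fun h => hna' (by rw [sub_eq_zero.mp h, ha1])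
    have hab : a - b ≠ 0 := fun h => hne (by rw [sub_eq_zero.mp h])
    have c1 := commute_starHom_sub_mul_inv hneg f1 ha0 hb0 hx1 hne hn hna' hb1
    have c2 := commute_starHom_sub_mul_inv hneg f2 hb0 ha0 hy1 hne.symm hn hnb' ha1
    rw [← starHom_neg hneg (b - a), neg_sub] at c2
    have c3 := c1.inv_left₀.mul_left c2
    rw [mul_inv_rev, inv_inv, mul_assoc, inv_mul_cancel_left₀ (hσ0 hab)] at c3
    set x := starHom N a
    set y := starHom N b
    set p := starHom N (a + n)
    set c := starHom N (n - 1)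
    have d1 : Commute p x := commute_starHom_add hn
    have d2 : Commute p c := by
      have e : a + n = (n - 1) + (a + 1) := by abel
      change Commute (starHom N (a + n)) (starHom N (n - 1))
      rw [e]
      exact commute_starHom_add ha1
    have conj : ∀ {u v : WithZero (Dˣ ⧸ N)}, Commute u v → Commute (x⁻¹ * u * x) (x⁻¹ * v * x) := by
      intro u v h
      rw [commute_iff_eq]
      simp only [mul_assoc, mul_inv_cancel_left₀ hx0]
      rw [← mul_assoc u v, h.eq, mul_assoc]
    have hne1 : ∀ {u : WithZero (Dˣ ⧸ N)}, u ≠ 1 → x⁻¹ * u * x ≠ 1 := by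
      intro u hu h
      apply hu
      have := congrArg (fun t => x * t * x⁻¹) h
      simpa [mul_assoc, hx0] using this
    have hne0 : ∀ {u : WithZero (Dˣ ⧸ N)}, u ≠ 0 → x⁻¹ * u * x ≠ 0 := fun hu =>
      mul_ne_zero (mul_ne_zero (inv_ne_zero hx0) hu) hx0
    have c4 := (conj c3.symm).inv_right₀
    have e5 : (x⁻¹ * (x * y⁻¹) * x)⁻¹ = x⁻¹ * y := by
      rw [inv_mul_cancel_left₀ hx0, mul_inv_rev, inv_inv]
    rw [e5] at c4
    have c5 := conj d1
    rw [inv_mul_cancel₀ hx0, one_mul] at c5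
    exact h2 _ _ (hne0 (hσ0 (add_ne_zero_of_starHom hneg hx1 hn))) (hne1 hna')
      (hne0 (hσ0 hn1)) (hne1 hc) c5.symm (conj d2) c4

end Star

end DivGroup

namespace DivGroup

/-! ### Hales-Jewett colourings by cosets of `N` -/

section HalesJewett

variable {D : Type*} [DivisionRing D] (N : Subgroup Dˣ) [N.Normal]

/-- A consequence of the Hales-Jewett theorem: the elements `1 + e * r q`, where `r q` runs through
finitely many units, all lie in `N` for a suitable `e` with controlled numerator and denominator. -/
theorem exists_forall_one_add_mul_mem [Finite (Dˣ ⧸ N)] : ∃ (ι : Type) (_ : Fintype ι),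
    ∀ (r : Dˣ ⧸ N → Dˣ) (d : ι → D), (∀ I : Finset ι, I.Nonempty → ∑ i ∈ I, d i ≠ 0) →
      ∃ (I J : Finset ι) (x : ι → Dˣ ⧸ N), I.Nonempty ∧ ∑ i ∈ J, d i * (r (x i) : D) ≠ 0 ∧
        ∀ q, starHom N (1 + (∑ i ∈ J, d i * (r (x i) : D))⁻¹ * (∑ i ∈ I, d i) * r q) = 1 := by
  classical
  have : Finite (WithZero (Dˣ ⧸ N)) := inferInstanceAs (Finite (Option (Dˣ ⧸ N)))
  obtain ⟨ι, hι, H⟩ := Combinatorics.Line.exists_mono_in_high_dimension (Option (Dˣ ⧸ N))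
    (WithZero (Dˣ ⧸ N))
  refine ⟨ι, hι, fun r d hd => ?_⟩
  -- The letter `none` stands for `0`, and a word is coloured by the image of its weighted sum. On a
  -- monochromatic line the sums are `b + e * val o`, and `o = none` shows that their common colour
  -- is that of `b`.
  let val : Option (Dˣ ⧸ N) → D := fun o => o.elim 0 fun q => (r q : D)
  obtain ⟨l, c, hl⟩ := H fun v => starHom N (∑ i, d i * val (v i))
  let I : Finset ι := Finset.univ.filter fun i => l.idxFun i = none
  let J : Finset ι := Finset.univ.filter fun i => ∃ q, l.idxFun i = some (some q)
  -- The default values are irrelevant, since only the `x i` with `i ∈ J` are used.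
  let x : ι → Dˣ ⧸ N := fun i => ((l.idxFun i).getD none).getD 1
  have hI : I.Nonempty := by
    obtain ⟨i, hi⟩ := l.proper
    exact ⟨i, by simp [I, hi]⟩
  set b := ∑ i ∈ J, d i * (r (x i) : D) with hb
  set e := ∑ i ∈ I, d i with he
  have hsum : ∀ o : Option (Dˣ ⧸ N), ∑ i, d i * val (l o i) = b + e * val o := by
    intro o
    rw [hb, he, Finset.sum_mul, Finset.sum_filter, Finset.sum_filter, ← Finset.sum_add_distrib]
    refine Finset.sum_congr rfl fun i _ => ?_
    rw [Combinatorics.Line.coe_apply]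
    rcases h : l.idxFun i with _ | _ | q
    · simp
    · simp [val]
    · simp [val, x, h]
  have hmono : ∀ q : Dˣ ⧸ N, starHom N (b + e * r q) = starHom N b := by
    intro q
    have h1 := hl (some q)
    have h2 := hl none
    simp only [hsum] at h1 h2
    rw [← h2] at h1
    simpa [val] using h1
  have hb0 : b ≠ 0 := by
    intro h0
    have h1 := hmono 1
    rw [h0, zero_add, map_zero, map_eq_zero] at h1
    exact mul_ne_zero (hd I hI) (r 1).ne_zero h1
  refine ⟨I, J, x, hI, hb0, fun q => ?_⟩
  have h1 : 1 + b⁻¹ * e * r q = b⁻¹ * (b + e * r q) := by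
    rw [mul_add, inv_mul_cancel₀ hb0, mul_assoc]
  rw [h1, map_mul, hmono, map_inv₀, inv_mul_cancel₀]
  exact (map_ne_zero _).mpr hb0

theorem exists_forall_sum_ne_zero [Infinite D] {ι : Type*} (s : Finset ι) :
    ∃ d : ι → D, ∀ I ⊆ s, I.Nonempty → ∑ i ∈ I, d i ≠ 0 := by
  classical
  induction s using Finset.induction_on with
  | empty => exact ⟨fun _ => 0, fun I hI hne => absurd (Finset.subset_empty.mp hI) hne.ne_empty⟩
  | insert j s hj ih =>
    obtain ⟨d, hd⟩ := ih
    obtain ⟨y, hy⟩ := Infinite.exists_notMem_finset (s.powerset.image fun I => -∑ i ∈ I, d i)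
    have hsame : ∀ I ⊆ s, ∑ i ∈ I, Function.update d j y i = ∑ i ∈ I, d i := fun I hI =>
      Finset.sum_congr rfl fun i hi => Function.update_of_ne (by rintro rfl; exact hj (hI hi)) _ _
    refine ⟨Function.update d j y, fun I hI hne => ?_⟩
    by_cases hjI : j ∈ I
    · have hsub : I.erase j ⊆ s := fun i hi =>
        (Finset.mem_insert.mp (hI (Finset.mem_of_mem_erase hi))).resolve_left
          (Finset.ne_of_mem_erase hi)
      rw [← Finset.add_sum_erase _ _ hjI, Function.update_self, hsame _ hsub]
      intro h
      exact hy (Finset.mem_image.mpr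
        ⟨_, Finset.mem_powerset.mpr hsub, (eq_neg_of_add_eq_zero_left h).symm⟩)
    · have hsub : I ⊆ s := fun i hi =>
        (Finset.mem_insert.mp (hI hi)).resolve_left fun h => hjI (h ▸ hi)
      rw [hsame _ hsub]
      exact hd I hsub hne

/-- A normal subgroup of finite index in an infinite division ring satisfies `D = N - N`. -/
theorem nD_nonempty [Infinite D] [Finite (Dˣ ⧸ N)] {c : D} (hc : c ≠ 0) : (nD N c).Nonempty := by
  classical
  obtain ⟨ι, hι, H⟩ := exists_forall_one_add_mul_mem N
  obtain ⟨d, hd⟩ := exists_forall_sum_ne_zero (D := D) (Finset.univ : Finset ι)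
  obtain ⟨I, J, x, hI, hb, h⟩ := H Quotient.out d fun I => hd I (Finset.subset_univ I)
  set e := (∑ i ∈ J, d i * ((Quotient.out (x i) : Dˣ) : D))⁻¹ * (∑ i ∈ I, d i) with he
  have he0 : e ≠ 0 := mul_ne_zero (inv_ne_zero hb) (hd I (Finset.subset_univ I) hI)
  clear_value e
  -- The coset is chosen so that `e * r q` and `c` agree modulo `N`; multiplying `1 + e * r q ∈ N`
  -- by a suitable element of `N` then turns its second term into `c`.
  let q : Dˣ ⧸ N := ((Units.mk0 e he0)⁻¹ * Units.mk0 c hc : Dˣ)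
  have hq : starHom N ((Quotient.out q : Dˣ) : D) = starHom N (e⁻¹ * c) := by
    rw [starHom_coe, QuotientGroup.out_eq']
    simp only [q]
    rw [← starHom_coe]
    simp
  have hσe : starHom N e ≠ 0 := (map_ne_zero _).mpr he0
  have hσc : starHom N c ≠ 0 := (map_ne_zero _).mpr hc
  have h1 : starHom N (c⁻¹ * (e * (Quotient.out q : Dˣ))) = 1 := by
    rw [map_mul, map_mul, hq, map_mul, map_inv₀, map_inv₀, mul_inv_cancel_left₀ hσe,
      inv_mul_cancel₀ hσc]
  set n := c⁻¹ * (e * (Quotient.out q : Dˣ)) with hn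
  have hn0 : n ≠ 0 := by
    intro h0
    rw [h0, map_zero] at h1
    exact zero_ne_one h1
  refine ⟨n⁻¹, by rw [map_inv₀, h1, inv_one], ?_⟩
  have h2 : c + n⁻¹ = (1 + e * (Quotient.out q : Dˣ)) * n⁻¹ := by
    rw [add_mul, one_mul, ← mul_inv_cancel_left₀ hc (e * _), ← hn, mul_assoc,
      mul_inv_cancel₀ hn0, mul_one, add_comm]
  rw [h2, map_mul, h, map_inv₀, h1, inv_one, mul_one]

end HalesJewett

/-! ### The `U`-Hypothesis from an oriented good pair -/

section UHyp

variable {D : Type*} [DivisionRing D] {N : Subgroup Dˣ} [N.Normal]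

/-- `(x, y)` is a good pair such that each `N(b)` with `b ∈ ℙ_y` contains some `N(a)` with
`a ∈ ℙ_x`. -/
def Dom (N : Subgroup Dˣ) [N.Normal] (x y : WithZero (Dˣ ⧸ N)) : Prop :=
  GoodPair N x y ∧ ∀ b : D, starHom N b = y → starHom N (b + 1) = 1 →
    ∃ a : D, starHom N a = x ∧ starHom N (a + 1) = 1 ∧ nD N a ⊆ nD N b

/-- If domination fails at some `b ∈ ℙ_y`, comparability gives `N(b) ⊆ N(a)` for every `a ∈ ℙ_x`, so
this single `b` serves all `a` in the reverse direction. -/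
theorem GoodPair.dom_or_dom {x y : WithZero (Dˣ ⧸ N)} (h : GoodPair N x y) :
    Dom N x y ∨ Dom N y x := by
  by_cases hD : Dom N x y
  · exact Or.inl hD
  · refine Or.inr ⟨h.symm, fun a ha ha1 => ?_⟩
    have h2 : ¬ ∀ b : D, starHom N b = y → starHom N (b + 1) = 1 →
      ∃ a : D, starHom N a = x ∧ starHom N (a + 1) = 1 ∧ nD N a ⊆ nD N b := fun h' => hD ⟨h, h'⟩
    push Not at h2
    obtain ⟨b, hb, hb1, h3⟩ := h2
    exact ⟨b, hb, hb1, (h a b ha hb).1.resolve_left (h3 a ha ha1)⟩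

theorem starHom_conj_eq_one (u : Dˣ) {d : D} :
    starHom N (u * d * ↑u⁻¹) = 1 ↔ starHom N d = 1 := by
  have hu : starHom N (u : D) ≠ 0 := (map_ne_zero _).mpr u.ne_zero
  rw [map_mul, map_mul, Units.val_inv_eq_inv_val, map_inv₀, mul_inv_eq_one₀ hu]
  exact mul_eq_left₀ hu

theorem conj_mem_nD (u : Dˣ) {a n : D} :
    u * n * ↑u⁻¹ ∈ nD N (u * a * ↑u⁻¹) ↔ n ∈ nD N a := by
  unfold nD
  rw [Set.mem_ofPred_eq, Set.mem_ofPred_eq, starHom_conj_eq_one, ← add_mul, ← mul_add,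
    starHom_conj_eq_one]

theorem nD_conj_subset (u : Dˣ) {a b : D} :
    nD N (u * a * ↑u⁻¹) ⊆ nD N (u * b * ↑u⁻¹) ↔ nD N a ⊆ nD N b := by
  constructor
  · intro h n hn
    exact (conj_mem_nD u).mp (h ((conj_mem_nD u).mpr hn))
  · intro h n hn
    have hn' : n = u * (↑u⁻¹ * n * u) * ↑u⁻¹ := by simp [mul_assoc]
    rw [hn'] at hn ⊢
    exact (conj_mem_nD u).mpr (h ((conj_mem_nD u).mp hn))

theorem Dom.conj {x y : WithZero (Dˣ ⧸ N)} (h : Dom N x y) (u : Dˣ) :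
    Dom N (starHom N (u : D) * x * (starHom N (u : D))⁻¹)
      (starHom N (u : D) * y * (starHom N (u : D))⁻¹) := by
  have hu : starHom N (u : D) ≠ 0 := (map_ne_zero _).mpr u.ne_zero
  have hback : ∀ {d : D} {z : WithZero (Dˣ ⧸ N)},
      starHom N d = starHom N (u : D) * z * (starHom N (u : D))⁻¹ →
        ∃ d' : D, d = u * d' * ↑u⁻¹ ∧ starHom N d' = z := by
    intro d z hd
    refine ⟨↑u⁻¹ * d * u, by simp [mul_assoc], ?_⟩
    rw [map_mul, map_mul, hd, Units.val_inv_eq_inv_val, map_inv₀]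
    simp [mul_assoc, hu]
  have hadd : ∀ d : D, (u : D) * d * ↑u⁻¹ + 1 = u * (d + 1) * ↑u⁻¹ := by
    intro d
    rw [mul_add, add_mul, mul_one, Units.mul_inv]
  refine ⟨fun a b ha hb => ?_, fun b hb hb1 => ?_⟩
  · obtain ⟨a, rfl, ha'⟩ := hback ha
    obtain ⟨b, rfl, hb'⟩ := hback hb
    refine ⟨?_, fun ha1 hb1 n hn hna hnb => ?_⟩
    · rw [nD_conj_subset, nD_conj_subset]
      exact (h.1 a b ha' hb').1
    · rw [hadd, starHom_conj_eq_one] at ha1 hb1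
      have hn' : n = u * (↑u⁻¹ * n * u) * ↑u⁻¹ := by simp [mul_assoc]
      rw [hn', conj_mem_nD] at hna hnb
      rw [hn', starHom_conj_eq_one] at hn
      have := (h.1 a b ha' hb').2 ha1 hb1 _ hn hna hnb
      rw [← starHom_conj_eq_one u, mul_sub, sub_mul, mul_one, Units.mul_inv, ← hn'] at this
      exact this
  · obtain ⟨b, rfl, hb'⟩ := hback hb
    rw [hadd, starHom_conj_eq_one] at hb1
    obtain ⟨a, ha, ha1, hab⟩ := h.2 b hb' hb1
    refine ⟨u * a * ↑u⁻¹, ?_, ?_, (nD_conj_subset u).mpr hab⟩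
    · rw [map_mul, map_mul, ha, Units.val_inv_eq_inv_val, map_inv₀]
    · rwa [hadd, starHom_conj_eq_one]

theorem mem_nClass_iff (C : ConjClasses (Dˣ ⧸ N)) {n : Dˣ} :
    n ∈ nClass N C ↔ starHom N (n : D) = 1 ∧ ∀ b : D, (∃ y ∈ C.carrier, starHom N b = y) →
      starHom N (b + 1) = 1 → starHom N (b + n) = 1 := by
  simp only [nClass, nElem, pElem, Set.mem_iInter, Set.mem_ofPred_eq, mem_nSet_iff,
    starHom_coe_eq_one N (a := n), Units.val_one, map_one, true_and]
  constructor
  · intro h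
    obtain ⟨y, hy⟩ := C.exists_rep
    refine ⟨(h y (ConjClasses.mem_carrier_iff_mk_eq.mpr hy)).1, ?_⟩
    rintro b ⟨z, hz, hbz⟩ hb1
    have hb0 : b ≠ 0 := by
      rintro rfl
      simp at hbz
    have hbz' : ((Units.mk0 b hb0 : Dˣ) : Dˣ ⧸ N) = z := by
      rw [← WithZero.coe_inj, ← starHom_coe, Units.val_mk0, hbz]
    exact ((h z hz).2 (Units.mk0 b hb0) ⟨hbz', hb1⟩).2
  · rintro ⟨hn, h⟩ y hy
    refine ⟨hn, fun a ha => ⟨hn, h a ⟨y, hy, ?_⟩ ha.2⟩⟩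
    rw [starHom_coe, ha.1]

theorem coe_ne_one_of_mem_carrier {X : Type*} [Group X] {C : ConjClasses X} (hC : C ≠ 1) {y : X}
    (hy : y ∈ C.carrier) : (y : WithZero X) ≠ 1 := by
  intro h
  rw [← WithZero.coe_one, WithZero.coe_inj] at h
  exact hC (by rw [← ConjClasses.mem_carrier_iff_mk_eq.mp hy, h, ConjClasses.one_eq_mk_one])

theorem uHypothesis_of_dom [Infinite D] [Finite (Dˣ ⧸ N)] (hneg : starHom N (-1 : D) = 1)
    {C : ConjClasses (Dˣ ⧸ N)} (hC : C ≠ 1)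
    (H : ∀ y ∈ C.carrier, ∃ x : WithZero (Dˣ ⧸ N), Dom N x y) : UHypothesis N (nClass N C) := by
  have hne1 : ∀ {b : D}, (∃ y ∈ C.carrier, starHom N b = y) → starHom N b ≠ 1 := by
    rintro b ⟨y, hy, hb⟩
    rw [hb]
    exact coe_ne_one_of_mem_carrier hC hy
  have hmul : ∀ s ∈ nClass N C, ∀ t ∈ nClass N C, s * t ∈ nClass N C := by
    intro s hs t ht
    rw [mem_nClass_iff] at hs ht ⊢
    refine ⟨by rw [Units.val_mul, map_mul, hs.1, ht.1, one_mul], fun b hb hb1 => ?_⟩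
    have h1 : starHom N ((s : D)⁻¹ * b) = starHom N b := by
      rw [map_mul, map_inv₀, hs.1, inv_one, one_mul]
    have h2 : starHom N ((s : D)⁻¹ * b + 1) = 1 := by
      have : (s : D)⁻¹ * b + 1 = (s : D)⁻¹ * (b + s) := by
        rw [mul_add, inv_mul_cancel₀ s.ne_zero]
      rw [this, map_mul, map_inv₀, hs.1, hs.2 b hb hb1, inv_one, one_mul]
    have h3 := ht.2 ((s : D)⁻¹ * b) (by rw [h1]; exact hb) h2
    have h4 : b + ((s * t : Dˣ) : D) = s * ((s : D)⁻¹ * b + t) := by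
      rw [mul_add, mul_inv_cancel_left₀ s.ne_zero, Units.val_mul]
    rw [h4, map_mul, hs.1, h3, one_mul]
  have hone : (1 : Dˣ) ∈ nClass N C := by
    rw [mem_nClass_iff]
    exact ⟨by simp, fun b _ hb1 => hb1⟩
  have hnegone : (-1 : Dˣ) ∈ nClass N C := by
    rw [mem_nClass_iff]
    refine ⟨by simpa using hneg, fun b hb hb1 => ?_⟩
    obtain ⟨y, hy, hby⟩ := hb
    obtain ⟨x, hgood, hdom⟩ := H y hy
    obtain ⟨a, ha, ha1, hab⟩ := hdom b hby hb1
    by_contra hcon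
    rw [Units.val_neg, Units.val_one] at hcon
    -- `-b` also lies over `y`, so `N(a)` and `N(-b)` are comparable. One inclusion is tested on
    -- `1`, the other on `-1`, using `N(a) ⊆ N(b)`.
    rcases (hgood a (-b) ha (by rw [starHom_neg hneg, hby])).1 with h | h
    · have h1 := (h (show (1 : D) ∈ nD N a from ⟨map_one _, ha1⟩)).2
      rw [← starHom_neg hneg, neg_add, neg_neg] at h1
      exact hcon h1
    · refine hcon (hab (h ⟨hneg, ?_⟩)).2
      rw [← neg_add, starHom_neg hneg, hb1]
  have hsub : ∀ n ∈ N, n ∉ nClass N C → starHom N ((n : D) - 1) = 1 := by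
    intro n hn hnS
    rw [mem_nClass_iff] at hnS
    push Not at hnS
    have hn1 := (starHom_coe_eq_one N).mpr hn
    obtain ⟨b, ⟨y, hy, hby⟩, hb1, hbn⟩ := hnS hn1
    obtain ⟨x, hgood, hdom⟩ := H y hy
    obtain ⟨a, ha, ha1, hab⟩ := hdom b hby hb1
    exact (hgood a b ha hby).2 ha1 hb1 n hn1 (fun h => hbn (hab h).2) (fun h => hbn h.2)
  have hnegmem : ∀ n ∈ nClass N C, -n ∈ nClass N C := fun n hn => by
    rw [← neg_one_mul]
    exact hmul _ hnegone _ hn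
  have hNneg : ∀ n ∈ N, -n ∈ N := fun n hn => by
    rw [← starHom_coe_eq_one N] at hn ⊢
    rw [Units.val_neg, starHom_neg hneg, hn]
  have hadd : ∀ n ∈ N, n ∉ nClass N C → starHom N ((n : D) + 1) = 1 := by
    intro n hn hnS
    have := hsub (-n) (hNneg n hn) (fun h => hnS (by simpa using hnegmem _ h))
    rwa [Units.val_neg, ← neg_add', starHom_neg hneg] at this
  -- If `m ∈ S`, then `m⁻¹n ∉ S` because `S` is closed under products, so `m + n = m(1 + m⁻¹n)`
  -- would lie in `N`.
  have hadd' : ∀ n ∈ N, n ∉ nClass N C → ∀ m ∈ N, starHom N ((m : D) + n) ≠ 1 →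
      m ∉ nClass N C := by
    intro n hn hnS m hm hmn hmS
    have h1 : m⁻¹ * n ∈ nClass N C := by
      by_contra hcon
      apply hmn
      have h3 : (m : D) + n = m * (((m⁻¹ * n : Dˣ) : D) + 1) := by
        rw [mul_add, Units.val_mul, Units.mul_inv_cancel_left, mul_one, add_comm]
      rw [h3, map_mul, hadd _ (N.mul_mem (N.inv_mem hm) hn) hcon, (starHom_coe_eq_one N).mpr hm,
        one_mul]
    exact hnS (by simpa using hmul _ hmS _ h1)
  refine ⟨⟨1, hone⟩, ?_, ?_, hone, hnegone, ?_, ?_, ?_⟩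
  · intro g s hs
    rw [mem_nClass_iff] at hs ⊢
    have hconj : ∀ d : D, d + ((g⁻¹ * s * g : Dˣ) : D) = ((g⁻¹ : Dˣ) : D) *
        ((g : D) * d * ((g⁻¹ : Dˣ) : D) + s) * ((g⁻¹)⁻¹ : Dˣ) := by
      intro d
      simp [mul_add, add_mul, mul_assoc]
    have hconj1 : ∀ d : D, (g : D) * d * ((g⁻¹ : Dˣ) : D) + 1 = g * (d + 1) * ((g⁻¹ : Dˣ) : D) := by
      intro d
      simp [mul_add, add_mul]
    refine ⟨?_, fun b hb hb1 => ?_⟩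
    · have := (starHom_conj_eq_one (N := N) g⁻¹ (d := (s : D))).mpr hs.1
      simpa using this
    · rw [hconj, starHom_conj_eq_one]
      refine hs.2 _ ?_ (by rw [hconj1, starHom_conj_eq_one, hb1])
      obtain ⟨y, hy, hby⟩ := hb
      refine ⟨(g : Dˣ ⧸ N) * y * (g : Dˣ ⧸ N)⁻¹, ?_, ?_⟩
      · rw [ConjClasses.mem_carrier_iff_mk_eq] at hy ⊢
        rw [← hy, ConjClasses.mk_eq_mk_iff_isConj]
        exact (isConj_iff.mpr ⟨_, rfl⟩).symm
      · rw [map_mul, map_mul, hby, starHom_coe, starHom_coe]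
        rfl
  · refine ⟨fun n hn => (starHom_coe_eq_one N).mp ((mem_nClass_iff C).mp hn).1, fun hall => ?_⟩
    -- Properness: by `D = N - N` there are `c` over the class with `c + 1 ∈ N`, and `s ∈ N` with
    -- `c⁻¹ + s ∈ N`. If `S = N`, then `c + s⁻¹ ∈ N`, and `c⁻¹ + s = c⁻¹(c + s⁻¹)s` forces `c ∈ N`.
    obtain ⟨y, hy⟩ := C.exists_rep
    obtain ⟨b, rfl⟩ := QuotientGroup.mk_surjective y
    obtain ⟨n, hn1, hn2⟩ := nD_nonempty N b.ne_zero
    have hn0 : n ≠ 0 := by rintro rfl; simp at hn1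
    have hb1 : starHom N (n⁻¹ * b + 1) = 1 := by
      have : n⁻¹ * (b : D) + 1 = n⁻¹ * (b + n) := by rw [mul_add, inv_mul_cancel₀ hn0]
      rw [this, map_mul, map_inv₀, hn1, hn2, inv_one, one_mul]
    have hbσ : starHom N (n⁻¹ * b) = ((b : Dˣ ⧸ N) : WithZero (Dˣ ⧸ N)) := by
      rw [map_mul, map_inv₀, hn1, inv_one, one_mul, starHom_coe]
    have hc0 : n⁻¹ * (b : D) ≠ 0 := mul_ne_zero (inv_ne_zero hn0) b.ne_zero
    set c := n⁻¹ * (b : D) with hc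
    have hcC : ∃ y ∈ C.carrier, starHom N c = y :=
      ⟨_, ConjClasses.mem_carrier_iff_mk_eq.mpr hy, hbσ⟩
    obtain ⟨s, hs1, hs2⟩ := nD_nonempty N (inv_ne_zero hc0)
    have hs0 : s ≠ 0 := by rintro rfl; simp at hs1
    have hsN : (Units.mk0 s hs0)⁻¹ ∈ N :=
      N.inv_mem ((starHom_coe_eq_one N).mp (by rwa [Units.val_mk0]))
    have h5 := ((mem_nClass_iff C).mp (hall hsN)).2 c hcC hb1
    rw [Units.val_inv_eq_inv_val, Units.val_mk0] at h5
    have h6 : c⁻¹ + s = c⁻¹ * (c + s⁻¹) * s := by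
      rw [mul_add, inv_mul_cancel₀ hc0, add_mul, one_mul, mul_assoc, inv_mul_cancel₀ hs0, mul_one,
        add_comm]
    rw [h6, map_mul, map_mul, h5, hs1, mul_one, mul_one, map_inv₀, inv_eq_one] at hs2
    exact hne1 hcC hs2
  · refine Set.Subset.antisymm ?_ fun s hs => ⟨s, hs, 1, hone, mul_one s⟩
    rintro _ ⟨s, hs, t, ht, rfl⟩
    exact hmul s hs t ht
  · rintro n ⟨hn, hnS⟩
    obtain ⟨m, hm, hmn⟩ := (starHom_eq_one_iff N).mp (hadd n hn hnS)
    refine ⟨m, ?_, hmn⟩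
    rw [mem_nClass_iff]
    refine ⟨(starHom_coe_eq_one N).mpr hm, fun b hb hb1 => ?_⟩
    rw [← hmn]
    -- With `k = b + 1 ∈ N`, failure means `k + n ∉ N`; hence `k ∉ S`, so `b = k - 1` would lie in
    -- `N`.
    by_contra hcon
    obtain ⟨k, hk, hkb⟩ := (starHom_eq_one_iff N).mp hb1
    have h1 : starHom N ((k : D) + n) ≠ 1 := by
      rw [← hkb]
      rwa [add_assoc, add_comm 1]
    have h2 := hsub k hk (hadd' n hn hnS k hk h1)
    rw [← hkb, add_sub_cancel_right] at h2
    exact hne1 hb h2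
  · rintro n ⟨hn, hnS⟩
    obtain ⟨m, hm, hmn⟩ := (starHom_eq_one_iff N).mp (hsub n hn hnS)
    exact ⟨m, hm, hmn⟩

end UHyp

end DivGroup

namespace DivGroup

/-! ### The ring attached to the `U`-Hypothesis -/

namespace UHypothesis

variable {D : Type*} [DivisionRing D] {N : Subgroup Dˣ} [N.Normal] {S : Set Dˣ}

omit [N.Normal] in
theorem mul_mem (h : UHypothesis N S) {s t : Dˣ} (hs : s ∈ S) (ht : t ∈ S) : s * t ∈ S :=
  h.mul_self ▸ Set.mul_mem_mul hs ht

omit [N.Normal] in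
theorem neg_mem (h : UHypothesis N S) {s : Dˣ} (hs : s ∈ S) : -s ∈ S :=
  neg_one_mul s ▸ h.mul_mem h.neg_one_mem hs

omit [N.Normal] in
theorem neg_mem_subgroup (h : UHypothesis N S) {n : Dˣ} (hn : n ∈ N) : -n ∈ N :=
  neg_one_mul n ▸ N.mul_mem (h.ssubset.1 h.neg_one_mem) hn

-- If the inverse of `u = 1 + n` were outside `S`, then `1 - u⁻¹ ∈ S`, and `n = u(1 - u⁻¹)` would
-- lie in `S`.
omit [N.Normal] in
theorem exists_eq_one_add (h : UHypothesis N S) {n : Dˣ} (hn : n ∈ N) (hnS : n ∉ S) :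
    ∃ u : Dˣ, (u : D) = 1 + n ∧ u ∈ S ∧ u⁻¹ ∈ S := by
  obtain ⟨s, hs, hsn⟩ := h.add_one n ⟨hn, hnS⟩
  refine ⟨s, by rw [← hsn, add_comm], hs, ?_⟩
  by_contra hp
  obtain ⟨t, ht, htp⟩ := h.add_one (-s⁻¹) ⟨h.neg_mem_subgroup (N.inv_mem (h.ssubset.1 hs)),
    fun h' => hp (by simpa using h.neg_mem h')⟩
  refine hnS ?_
  have : n = s * t := by
    ext
    rw [Units.val_mul, ← htp, mul_add, Units.val_neg, mul_neg, Units.mul_inv, ← hsn]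
    simp
  rw [this]
  exact h.mul_mem hs ht

-- If both fail, `n = (1 + n)(1 + n⁻¹)⁻¹` is a product of elements of `S`.
omit [N.Normal] in
theorem mem_or_inv_mem (h : UHypothesis N S) {n : Dˣ} (hn : n ∈ N) : n ∈ S ∨ n⁻¹ ∈ S := by
  by_contra! hcon
  obtain ⟨u, hu, huS, -⟩ := h.exists_eq_one_add hn hcon.1
  obtain ⟨v, hv, -, hvS⟩ := h.exists_eq_one_add (N.inv_mem hn) hcon.2
  refine hcon.1 ?_
  have : n = u * v⁻¹ := by
    rw [eq_mul_inv_iff_mul_eq]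
    ext
    rw [Units.val_mul, hu, hv, mul_add, mul_one, Units.mul_inv, add_comm]
  rw [this]
  exact h.mul_mem huS hvS

omit [N.Normal] in
theorem mul_notMem (h : UHypothesis N S) {s t : Dˣ} (hsS : s ∉ S) (ht : t ∈ N)
    (htS : t ∉ S) : s * t ∉ S := fun hst =>
  hsS (by simpa using h.mul_mem hst ((h.mem_or_inv_mem ht).resolve_left htS))

-- Here `m⁻¹ ∉ S` plays the role of value above `1`, and `w⁻¹ ∈ S` that of value at most `1`.
-- Subtracting `w` multiplies `m` by `1 - m⁻¹w`, which lies in `S` together with its inverse.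
omit [N.Normal] in
theorem exists_eq_sub (h : UHypothesis N S) {m w : Dˣ} (hm : m ∈ N) (hmS : m⁻¹ ∉ S)
    (hw : w⁻¹ ∈ S) : ∃ k ∈ N, k⁻¹ ∉ S ∧ (k : D) = m - w := by
  have hwN : w ∈ N := by simpa using N.inv_mem (h.ssubset.1 hw)
  obtain ⟨u, hu, huS, huS'⟩ := h.exists_eq_one_add (n := -(m⁻¹ * w))
    (h.neg_mem_subgroup (N.mul_mem (N.inv_mem hm) hwN)) (fun hk => hmS (by
      simpa using h.mul_mem (h.neg_mem hk) hw))
  refine ⟨m * u, N.mul_mem hm (h.ssubset.1 huS), fun hk => hmS ?_, ?_⟩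
  · simpa using h.mul_mem huS hk
  · rw [Units.val_mul, hu, mul_add, Units.val_neg, mul_neg, Units.val_mul,
      Units.mul_inv_cancel_left, mul_one, sub_eq_add_neg]

/-- The subring of `D` generated by the inverses of the elements of `S`. -/
def ring (S : Set Dˣ) : Subring D := Subring.closure {d | ∃ w : Dˣ, w⁻¹ ∈ S ∧ d = w}

-- The set of `m ∈ N` with `m⁻¹ ∉ S` is stable under translation by the ring. If it contained an
-- element `n` of the ring, it would contain `n - n = 0`, which is not a unit.
omit [N.Normal] in
theorem coe_mem_ring_iff (h : UHypothesis N S) {n : Dˣ} (hn : n ∈ N) :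
    (n : D) ∈ ring S ↔ n⁻¹ ∈ S := by
  refine ⟨fun hnR => ?_, fun hnS => Subring.subset_closure ⟨n, hnS, rfl⟩⟩
  have hmon : ∀ d ∈ Submonoid.closure {d : D | ∃ w : Dˣ, w⁻¹ ∈ S ∧ d = w},
      ∃ w : Dˣ, w⁻¹ ∈ S ∧ d = w := by
    intro d hd
    induction hd using Submonoid.closure_induction with
    | mem d hd => exact hd
    | one => exact ⟨1, by simpa using h.one_mem, rfl⟩
    | mul a b _ _ ha hb =>
      obtain ⟨a, ha, rfl⟩ := ha
      obtain ⟨b, hb, rfl⟩ := hb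
      exact ⟨a * b, by simpa using h.mul_mem hb ha, rfl⟩
  have key : ∀ d ∈ AddSubgroup.closure
      (Submonoid.closure {d : D | ∃ w : Dˣ, w⁻¹ ∈ S ∧ d = w} : Set D),
      ∀ m ∈ N, m⁻¹ ∉ S → (∃ k ∈ N, k⁻¹ ∉ S ∧ (k : D) = m - d) ∧
        (∃ k ∈ N, k⁻¹ ∉ S ∧ (k : D) = m + d) := by
    intro d hd
    induction hd using AddSubgroup.closure_induction with
    | mem d hd =>
      intro m hm hmS
      obtain ⟨w, hw, rfl⟩ := hmon d hd
      refine ⟨h.exists_eq_sub hm hmS hw, ?_⟩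
      obtain ⟨k, hk, hkS, hke⟩ := h.exists_eq_sub (w := -w) hm hmS (by simpa using h.neg_mem hw)
      exact ⟨k, hk, hkS, by rw [hke, Units.val_neg, sub_neg_eq_add]⟩
    | zero => exact fun m hm hmS => ⟨⟨m, hm, hmS, by simp⟩, ⟨m, hm, hmS, by simp⟩⟩
    | add a b _ _ ha hb =>
      intro m hm hmS
      obtain ⟨⟨k₁, h₁, h₁', e₁⟩, ⟨k₂, h₂, h₂', e₂⟩⟩ := ha m hm hmS
      obtain ⟨⟨k₃, h₃, h₃', e₃⟩, -⟩ := hb k₁ h₁ h₁'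
      obtain ⟨-, ⟨k₄, h₄, h₄', e₄⟩⟩ := hb k₂ h₂ h₂'
      exact ⟨⟨k₃, h₃, h₃', by rw [e₃, e₁, sub_sub]⟩, ⟨k₄, h₄, h₄', by rw [e₄, e₂, add_assoc]⟩⟩
    | neg a _ ha =>
      intro m hm hmS
      obtain ⟨h₁, h₂⟩ := ha m hm hmS
      rw [sub_neg_eq_add, ← sub_eq_add_neg]
      exact ⟨h₂, h₁⟩
  by_contra hnS
  obtain ⟨⟨k, -, -, hk⟩, -⟩ := key n (Subring.mem_closure_iff.mp hnR) n hn hnS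
  rw [sub_self] at hk
  exact k.ne_zero hk

variable {F : Type*} [Field F] [Algebra F D]

/-- The valuation subring of the center cut out by `UHypothesis.ring S`. -/
def valuationSubring (h : UHypothesis N S)
    (hFN : ∀ (α : F) (a : Dˣ), (a : D) = algebraMap F D α → a ∈ N) : ValuationSubring F where
  toSubring := (ring S).comap (algebraMap F D)
  mem_or_inv_mem' := by
    intro α
    by_cases hα : α = 0
    · left
      simp [hα]
    · have hα' : algebraMap F D α ≠ 0 := by simpa using hα
      have hN := hFN α (Units.mk0 _ hα') rfl
      have hinv : algebraMap F D α⁻¹ = ((Units.mk0 _ hα')⁻¹ : Dˣ) := by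
        simp
      change algebraMap F D α ∈ ring S ∨ algebraMap F D α⁻¹ ∈ ring S
      rw [hinv, h.coe_mem_ring_iff (N.inv_mem hN), inv_inv]
      exact (h.mem_or_inv_mem hN).symm.imp_left (h.coe_mem_ring_iff hN).mpr

omit [N.Normal] in
theorem mem_valuationSubring_iff (h : UHypothesis N S)
    (hFN : ∀ (α : F) (a : Dˣ), (a : D) = algebraMap F D α → a ∈ N) {α : F} :
    α ∈ h.valuationSubring hFN ↔ algebraMap F D α ∈ ring S := Iff.rfl

omit [N.Normal] in
theorem conj_mem (h : UHypothesis N S) (g : Dˣ) {s : Dˣ} (hs : s ∈ S) : g * s * g⁻¹ ∈ S := by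
  simpa using h.normal g⁻¹ s hs

variable [Algebra.IsCentral F D] [FiniteDimensional F D]

/-- The norm is a nonempty product of conjugates of `n`. As `S` is invariant under conjugation, all
their inverses lie on the same side of `S`, and both sides are closed under products. -/
theorem norm_mem_iff (h : UHypothesis N S)
    (hFN : ∀ (α : F) (a : Dˣ), (a : D) = algebraMap F D α → a ∈ N) {n : Dˣ} (hn : n ∈ N) :
    Algebra.norm F (n : D) ∈ h.valuationSubring hFN ↔ n⁻¹ ∈ S := by
  rw [mem_valuationSubring_iff]
  obtain ⟨l, hl0, hl, hln⟩ := exists_list_conj_norm_eq_prod (F := F) n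
  have hlN : l.prod ∈ N := Subgroup.list_prod_mem _ fun x hx => by
    obtain ⟨g, rfl⟩ := hl x hx
    exact (inferInstance : N.Normal).conj_mem _ hn g
  rw [hln, h.coe_mem_ring_iff hlN]
  constructor
  · intro hp
    by_contra hnS
    have key : ∀ l : List Dˣ, l ≠ [] → (∀ x ∈ l, ∃ g : Dˣ, x = g * n * g⁻¹) → l.prod⁻¹ ∉ S := by
      intro l
      induction l with
      | nil => exact fun h => absurd rfl h
      | cons x l ih =>
        intro _ hl
        obtain ⟨g, hg⟩ := hl x (List.mem_cons_self ..)
        have hxN : x⁻¹ ∈ N := by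
          rw [hg]
          exact N.inv_mem ((inferInstance : N.Normal).conj_mem _ hn g)
        have hxS : x⁻¹ ∉ S := by
          intro hx
          rw [hg] at hx
          exact hnS (by simpa [mul_assoc] using h.normal g _ hx)
        rw [List.prod_cons, mul_inv_rev]
        by_cases hl0 : l = []
        · simpa [hl0] using hxS
        · exact h.mul_notMem (ih hl0 fun y hy => hl y (List.mem_cons_of_mem _ hy)) hxN hxS
    exact key l hl0 hl hp
  · intro hnS
    have key : ∀ l : List Dˣ, (∀ x ∈ l, ∃ g : Dˣ, x = g * n * g⁻¹) → l.prod⁻¹ ∈ S := by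
      intro l
      induction l with
      | nil => exact fun _ => by simpa using h.one_mem
      | cons x l ih =>
        intro hl
        obtain ⟨g, hg⟩ := hl x (List.mem_cons_self ..)
        rw [List.prod_cons, mul_inv_rev]
        refine h.mul_mem (ih fun y hy => hl y (List.mem_cons_of_mem _ hy)) ?_
        rw [hg]
        simpa [mul_assoc] using h.conj_mem g hnS
    exact key l hl

end UHypothesis

/-! ### The valuation of `D` -/

section Valuation

universe u

-- Multiplying a monic equation of degree `n + 1` by `x⁻¹ ^ n` expresses `x` as a polynomial in
-- `x⁻¹`.
open Polynomial in
theorem mem_of_isIntegral_of_inv_mem {K : Type*} [Field K] {A : Subring K} {x : K}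
    (hx : IsIntegral A x) (hinv : x⁻¹ ∈ A) : x ∈ A := by
  by_cases hx0 : x = 0
  · rw [hx0]
    exact A.zero_mem
  obtain ⟨p, hp, hpx⟩ := hx
  rw [hp.as_sum, eval₂_add, eval₂_X_pow, eval₂_finsetSum] at hpx
  rcases hn : p.natDegree with _ | n
  · rw [hn] at hpx
    simp at hpx
  · rw [hn] at hpx
    have h1 : x = -∑ i ∈ Finset.range (n + 1), (p.coeff i : K) * x⁻¹ ^ (n - i) := by
      have h2 : x ^ (n + 1) * (x⁻¹) ^ n = x := by
        rw [pow_succ', mul_assoc, ← mul_pow, mul_inv_cancel₀ hx0, one_pow, mul_one]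
      refine h2.symm.trans ?_
      rw [eq_neg_of_add_eq_zero_left hpx, neg_mul, Finset.sum_mul]
      congr 1
      refine Finset.sum_congr rfl fun i hi => ?_
      have h3 : x⁻¹ ^ n = x⁻¹ ^ i * x⁻¹ ^ (n - i) := by
        rw [← pow_add, Nat.add_sub_cancel' (Nat.lt_succ_iff.mp (Finset.mem_range.mp hi))]
      rw [eval₂_mul, eval₂_C, eval₂_X_pow, h3, mul_assoc, ← mul_assoc (x ^ i), ← mul_pow,
        mul_inv_cancel₀ hx0, one_pow, one_mul]
      rfl
    rw [h1]
    exact A.neg_mem (A.sum_mem fun i _ => A.mul_mem (p.coeff i).2 (A.pow_mem hinv _))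

open Polynomial in
/-- Every element of a division ring lies in the image of a field. -/
theorem exists_field_hom {F : Type u} {D : Type*} [Field F] [DivisionRing D] [Algebra F D]
    [FiniteDimensional F D] (x : D) :
    ∃ (K : Type u) (_ : Field K) (i : K →+* D) (ξ : K), i ξ = x := by
  have hint : IsIntegral F x := Algebra.IsIntegral.isIntegral _
  have : Fact (Irreducible (minpoly F x)) := ⟨minpoly.irreducible hint⟩
  refine ⟨AdjoinRoot (minpoly F x), inferInstance,
    Ideal.Quotient.lift _ (aeval x : F[X] →ₐ[F] D).toRingHom (fun a ha => ?_), AdjoinRoot.root _, ?_⟩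
  · obtain ⟨y, rfl⟩ := Ideal.mem_span_singleton.mp ha
    change aeval x (minpoly F x * y) = 0
    rw [map_mul, minpoly.aeval, zero_mul]
  · change aeval x X = x
    exact aeval_X x

variable {F : Type u} {D : Type*} [Field F] [DivisionRing D] [Algebra F D] [Algebra.IsCentral F D]
  [FiniteDimensional F D] {N : Subgroup Dˣ} [N.Normal] [Finite (Dˣ ⧸ N)] {S : Set Dˣ}

/-- The `U`-Hypothesis yields a valuation on `D` for which `N \ S` is the set of elements of `N` of value
less than `1`. -/
theorem UHypothesis.exists_valuation (h : UHypothesis N S)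
    (hFN : ∀ (α : F) (a : Dˣ), (a : D) = algebraMap F D α → a ∈ N) :
    ∃ (Γ : Type u) (_ : LinearOrderedCommGroupWithZero Γ) (v : Valuation D Γ),
      (∀ n ∈ N, v n < 1 ↔ n ∉ S) ∧ ∀ a : D, Algebra.norm F a = 1 → v a = 1 := by
  classical
  let O := h.valuationSubring hFN
  let v₀ : D →*₀ O.ValueGroup :=
    { toFun := fun d => O.valuation (Algebra.norm F d)
      map_zero' := by simp
      map_one' := by simp
      map_mul' := by simp }
  have hv : ∀ d, v₀ d = O.valuation (Algebra.norm F d) := fun _ => rfl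
  have hle : ∀ n ∈ N, v₀ (n : D) ≤ 1 ↔ n⁻¹ ∈ S := fun n hn => by
    rw [hv, ValuationSubring.valuation_le_one_iff, h.norm_mem_iff hFN hn]
  have hpowN : ∀ u : Dˣ, u ^ Nat.card (Dˣ ⧸ N) ∈ N := fun u => by
    rw [← QuotientGroup.eq_one_iff, QuotientGroup.mk_pow, pow_card_eq_one']
  have hr : Nat.card (Dˣ ⧸ N) ≠ 0 := Nat.card_pos.ne'
  -- Integrality is used inside a commutative field mapping onto `F(x)`. As `x ^ r` lies in the
  -- ring, `x` and hence `(x + 1) ^ r` are integral over it. The latter lies in `N`, so it or its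
  -- inverse is in the ring; integrality excludes that only the inverse is.
  have hadd1 : ∀ x : D, v₀ x ≤ 1 → v₀ (x + 1) ≤ 1 := by
    intro x hx
    by_cases hx0 : x = 0
    · simp [hx0]
    by_cases hx1 : x + 1 = 0
    · simp [hx1]
    obtain ⟨K, hK, i, ξ, hξ⟩ := exists_field_hom (F := F) x
    set r := Nat.card (Dˣ ⧸ N)
    have hxr := hpowN (Units.mk0 x hx0)
    have hyr := hpowN (Units.mk0 _ hx1)
    have hmem : ξ ^ r ∈ (ring S).comap i := by
      rw [Subring.mem_comap, map_pow, hξ]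
      have : (((Units.mk0 x hx0) ^ r : Dˣ) : D) = x ^ r := by simp
      rw [← this, h.coe_mem_ring_iff hxr, ← hle _ hxr, this, map_pow]
      exact pow_le_one' hx r
    have hint : IsIntegral ((ring S).comap i) ξ :=
      IsIntegral.of_pow (Nat.pos_of_ne_zero hr)
        (isIntegral_algebraMap (R := (ring S).comap i) (x := (⟨_, hmem⟩ : (ring S).comap i)))
    have hint2 : IsIntegral ((ring S).comap i) ((ξ + 1) ^ r) := (hint.add isIntegral_one).pow r
    have hy : (((Units.mk0 _ hx1) ^ r : Dˣ) : D) = (x + 1) ^ r := by simp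
    have hiy : i ((ξ + 1) ^ r) = (x + 1) ^ r := by rw [map_pow, map_add, hξ, map_one]
    have hy1 : v₀ ((x + 1) ^ r) ≤ 1 := by
      rw [← hy, hle _ hyr]
      rcases h.mem_or_inv_mem hyr with hyS | hyS
      · have hinv : ((ξ + 1) ^ r)⁻¹ ∈ (ring S).comap i := by
          rw [Subring.mem_comap, map_inv₀, hiy, ← hy, ← Units.val_inv_eq_inv_val,
            h.coe_mem_ring_iff (N.inv_mem hyr), inv_inv]
          exact hyS
        have : (ξ + 1) ^ r ∈ (ring S).comap i := by
          exact mem_of_isIntegral_of_inv_mem hint2 hinv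
        rwa [Subring.mem_comap, hiy, ← hy, h.coe_mem_ring_iff hyr] at this
      · exact hyS
    rw [map_pow] at hy1
    exact (pow_le_one_iff hr).mp hy1
  let v : Valuation D O.ValueGroup :=
    { v₀ with
      map_add_le_max' := by
        have aux : ∀ x y : D, v₀ x ≤ v₀ y → v₀ (x + y) ≤ v₀ y := by
          intro x y hxy
          by_cases hy : y = 0
          · rw [hy, map_zero, le_zero_iff, map_eq_zero] at hxy
            simp [hxy, hy]
          · have hvy : v₀ y ≠ 0 := (map_ne_zero _).mpr hy
            have h1 : x + y = (x * y⁻¹ + 1) * y := by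
              rw [add_mul, inv_mul_cancel_right₀ hy, one_mul]
            rw [h1, map_mul]
            refine mul_le_of_le_one_left' (hadd1 _ ?_)
            rw [map_mul, map_inv₀, ← div_eq_mul_inv]
            exact div_le_one_of_le₀ hxy zero_le
        intro x y
        change v₀ (x + y) ≤ max (v₀ x) (v₀ y)
        rcases le_total (v₀ x) (v₀ y) with hxy | hxy
        · exact (aux x y hxy).trans (le_max_right _ _)
        · rw [add_comm]
          exact (aux y x hxy).trans (le_max_left _ _) }
  refine ⟨O.ValueGroup, inferInstance, v, fun n hn => ?_, fun a ha => ?_⟩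
  · have h1 := hle n⁻¹ (N.inv_mem hn)
    rw [inv_inv, Units.val_inv_eq_inv_val, map_inv₀] at h1
    have h2 : v₀ (n : D) ≠ 0 := (map_ne_zero _).mpr n.ne_zero
    change v₀ (n : D) < 1 ↔ _
    rw [← h1, not_le, one_lt_inv₀ (zero_lt_iff.mpr h2)]
  · change O.valuation (Algebra.norm F a) = 1
    rw [ha, map_one]

end Valuation

/-! ### Congruence subgroups, and `1 + d ∈ N` for `d` of value below `1` -/

section OneAdd

variable {D : Type*} [DivisionRing D] {N : Subgroup Dˣ} [N.Normal]

/-- The congruence subgroup of level `γ < 1` of a valued division ring. -/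
def congruenceSubgroup {Γ : Type*} [LinearOrderedCommGroupWithZero Γ] (v : Valuation D Γ) (γ : Γ)
    (hγ : γ < 1) : Subgroup Dˣ where
  carrier := {u | v ((u : D) - 1) ≤ γ}
  one_mem' := by simp
  mul_mem' := by
    intro a b ha hb
    have hb1 : v (b : D) = 1 := by
      have := v.map_one_add_of_lt (lt_of_le_of_lt hb hγ)
      rwa [add_sub_cancel] at this
    have h1 : ((a * b : Dˣ) : D) - 1 = (a - 1) * b + (b - 1) := by
      rw [Units.val_mul]; noncomm_ring
    change v (((a * b : Dˣ) : D) - 1) ≤ γ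
    rw [h1]
    refine v.map_add_le ?_ hb
    rw [map_mul, hb1, mul_one]
    exact ha
  inv_mem' := by
    intro a ha
    have ha1 : v (a : D) = 1 := by
      have := v.map_one_add_of_lt (lt_of_le_of_lt ha hγ)
      rwa [add_sub_cancel] at this
    have h1 : ((a⁻¹ : Dˣ) : D) - 1 = -(((a⁻¹ : Dˣ) : D) * (a - 1)) := by
      rw [mul_sub, Units.inv_mul]; noncomm_ring
    change v (((a⁻¹ : Dˣ) : D) - 1) ≤ γ
    rw [h1, v.map_neg, map_mul, Units.val_inv_eq_inv_val, map_inv₀, ha1, inv_one, one_mul]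
    exact ha

theorem mem_congruenceSubgroup {Γ : Type*} [LinearOrderedCommGroupWithZero Γ] {v : Valuation D Γ}
    {γ : Γ} {hγ : γ < 1} {u : Dˣ} : u ∈ congruenceSubgroup v γ hγ ↔ v ((u : D) - 1) ≤ γ := Iff.rfl

instance {Γ : Type*} [LinearOrderedCommGroupWithZero Γ] (v : Valuation D Γ) (γ : Γ)
    (hγ : γ < 1) : (congruenceSubgroup v γ hγ).Normal where
  conj_mem n hn g := by
    rw [mem_congruenceSubgroup] at hn ⊢
    have h1 : ((g * n * g⁻¹ : Dˣ) : D) - 1 = g * (n - 1) * ((g⁻¹ : Dˣ) : D) := by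
      rw [mul_sub, sub_mul, mul_one, Units.mul_inv, Units.val_mul, Units.val_mul]
    have hg : v (g : D) ≠ 0 := (map_ne_zero v).mpr g.ne_zero
    rwa [h1, map_mul, map_mul, Units.val_inv_eq_inv_val, map_inv₀, mul_right_comm,
      mul_inv_cancel₀ hg, one_mul]

/-- The reason is `ab - ba = (a - 1)(b - 1) - (b - 1)(a - 1)`, whose terms have value at most `γ *
γ`. -/
theorem commutator_mem_congruenceSubgroup {Γ : Type*} [LinearOrderedCommGroupWithZero Γ]
    {v : Valuation D Γ} {γ : Γ} {hγ : γ < 1} {hγ' : γ * γ < 1} {a b : Dˣ}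
    (ha : a ∈ congruenceSubgroup v γ hγ) (hb : b ∈ congruenceSubgroup v γ hγ) :
    a * b * a⁻¹ * b⁻¹ ∈ congruenceSubgroup v (γ * γ) hγ' := by
  rw [mem_congruenceSubgroup] at ha hb ⊢
  have ha1 : v (a : D) = 1 := by
    have := v.map_one_add_of_lt (lt_of_le_of_lt ha hγ)
    rwa [add_sub_cancel] at this
  have hb1 : v (b : D) = 1 := by
    have := v.map_one_add_of_lt (lt_of_le_of_lt hb hγ)
    rwa [add_sub_cancel] at this
  have h1 : ((a * b * a⁻¹ * b⁻¹ : Dˣ) : D) - 1 =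
      (((a : D) - 1) * (b - 1) - (b - 1) * (a - 1)) * (((a⁻¹ : Dˣ) : D) * ((b⁻¹ : Dˣ) : D)) := by
    have h2 : ((a : D) - 1) * (b - 1) - (b - 1) * (a - 1) = a * b - b * a := by noncomm_ring
    rw [h2, sub_mul]
    congr 1
    · simp [mul_assoc]
    · rw [mul_assoc, Units.mul_inv_cancel_left, Units.mul_inv]
  rw [h1, map_mul, map_mul, Units.val_inv_eq_inv_val, Units.val_inv_eq_inv_val, map_inv₀, map_inv₀,
    ha1, hb1, inv_one, mul_one, mul_one]
  refine v.map_sub_le ?_ ?_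
  · rw [map_mul]; exact mul_le_mul' ha hb
  · rw [map_mul]; exact mul_le_mul' hb ha

/-- If `1 + d ∈ N` for all `d ∈ N` of value less than `1`, then this holds for all such `d ∈ D`. -/
theorem starHom_one_add_of_lt_one [Finite (Dˣ ⧸ N)] [IsSimpleGroup (Dˣ ⧸ N)]
    (hnonabelian : ∃ x y : Dˣ ⧸ N, x * y ≠ y * x) (hneg : starHom N (-1 : D) = 1)
    {Γ : Type*} [LinearOrderedCommGroupWithZero Γ] (v : Valuation D Γ)
    (hv : ∀ d : D, starHom N d = 1 → v d < 1 → starHom N (1 + d) = 1) {p : D} (hp : v p < 1) :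
    starHom N (1 + p) = 1 := by
  classical
  by_contra hp1
  have hp0 : p ≠ 0 := by rintro rfl; simp at hp1
  have hγ0 : v p ≠ 0 := (map_ne_zero v).mpr hp0
  have hγ : ∀ k : ℕ, v p ^ (2 ^ k) < 1 := fun k => pow_lt_one' hp (by positivity)
  -- Images are normal in a simple group. Level `0` contains `1 + p ∉ N`; if one level surjects but
  -- the next has trivial image, the commutator estimate makes the quotient abelian.
  have himage : ∀ k, (congruenceSubgroup v _ (hγ k)).map (QuotientGroup.mk' N) = ⊤ := by
    intro k
    induction k with
    | zero =>
      refine (Subgroup.Normal.eq_bot_or_eq_top (Subgroup.Normal.map inferInstance _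
        (QuotientGroup.mk'_surjective N))).resolve_left fun hbot => hp1 ?_
      have hvp : v (1 + p) = 1 := v.map_one_add_of_lt hp
      have h10 : 1 + p ≠ 0 := fun h => by rw [h, map_zero] at hvp; exact zero_ne_one hvp
      have hmem : Units.mk0 _ h10 ∈ congruenceSubgroup v _ (hγ 0) := by
        rw [mem_congruenceSubgroup]
        simp
      have h2 := Subgroup.mem_map_of_mem (QuotientGroup.mk' N) hmem
      rw [hbot, Subgroup.mem_bot, QuotientGroup.mk'_apply, QuotientGroup.eq_one_iff] at h2
      exact (starHom_coe_eq_one N).mpr h2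
    | succ k ih =>
      refine (Subgroup.Normal.eq_bot_or_eq_top (Subgroup.Normal.map inferInstance _
        (QuotientGroup.mk'_surjective N))).resolve_left fun hbot => ?_
      obtain ⟨x, y, hxy⟩ := hnonabelian
      have hx : x ∈ (congruenceSubgroup v _ (hγ k)).map (QuotientGroup.mk' N) := ih ▸ Subgroup.mem_top x
      have hy : y ∈ (congruenceSubgroup v _ (hγ k)).map (QuotientGroup.mk' N) := ih ▸ Subgroup.mem_top y
      obtain ⟨a, ha, rfl⟩ := hx
      obtain ⟨b, hb, rfl⟩ := hy
      have hsq : v p ^ (2 ^ (k + 1)) = v p ^ (2 ^ k) * v p ^ (2 ^ k) := by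
        rw [← pow_add]; congr 1; ring
      have hc : a * b * a⁻¹ * b⁻¹ ∈ congruenceSubgroup v _ (hγ (k + 1)) := by
        have := commutator_mem_congruenceSubgroup (hγ' := hsq ▸ hγ (k + 1)) ha hb
        rw [mem_congruenceSubgroup] at this ⊢
        rwa [hsq]
      have h2 := Subgroup.mem_map_of_mem (QuotientGroup.mk' N) hc
      rw [hbot, Subgroup.mem_bot, map_mul, map_mul, map_mul, map_inv, map_inv, mul_inv_eq_one,
        mul_inv_eq_iff_eq_mul] at h2
      exact hxy h2
  have hsec : ∀ q : Dˣ ⧸ N, ∃ u : Dˣ, v (u : D) = 1 ∧ (u : Dˣ ⧸ N) = q := by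
    intro q
    have hq : q ∈ (congruenceSubgroup v _ (hγ 0)).map (QuotientGroup.mk' N) :=
      himage 0 ▸ Subgroup.mem_top q
    obtain ⟨u, hu, rfl⟩ := hq
    refine ⟨u, ?_, rfl⟩
    have := v.map_one_add_of_lt (lt_of_le_of_lt hu (hγ 0))
    rwa [add_sub_cancel] at this
  choose r hr1 hr2 using hsec
  obtain ⟨ι, hι, H⟩ := exists_forall_one_add_mul_mem N
  let e := Fintype.equivFin ι
  set K := Fintype.card ι
  -- The weights are distinct powers of `p`, so the smallest exponent determines the value of a
  -- partial sum. This bounds the numerator of `f` below, while representatives of value `1` bound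
  -- its denominator above.
  have hsum : ∀ I : Finset ι, I.Nonempty → v p ^ K ≤ v (∑ i ∈ I, p ^ (e i : ℕ)) := by
    intro I hI
    obtain ⟨j, hj, hmin⟩ := Finset.exists_min_image I (fun i => (e i : ℕ)) hI
    have : v (∑ i ∈ I, p ^ (e i : ℕ)) = v (p ^ (e j : ℕ)) := by
      refine v.map_sum_eq_of_lt hj fun i hi => ?_
      rw [Finset.mem_sdiff, Finset.mem_singleton] at hi
      rw [map_pow, map_pow]
      refine pow_lt_pow_right_of_lt_one₀ (zero_lt_iff.mpr hγ0) hp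
        (lt_of_le_of_ne (hmin i hi.1) fun h => hi.2 (e.injective (Fin.ext h.symm)))
    rw [this, map_pow]
    exact pow_le_pow_right_of_le_one' hp.le (e j).2.le
  obtain ⟨I, J, x, hI, hb0, h⟩ := H r (fun i => p ^ (e i : ℕ)) fun I hI h0 => by
    have := hsum I hI
    rw [h0, map_zero, le_zero_iff] at this
    exact pow_ne_zero _ hγ0 this
  set b := ∑ i ∈ J, p ^ (e i : ℕ) * (r (x i) : D) with hb
  have hbv : v b ≤ 1 := by
    refine v.map_sum_le fun i _ => ?_
    rw [map_mul, hr1, mul_one, map_pow]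
    exact pow_le_one' hp.le _
  set c := ∑ i ∈ I, p ^ (e i : ℕ) with hc
  have hcv : v p ^ K ≤ v c := hsum I hI
  have hvb0 : v b ≠ 0 := (map_ne_zero v).mpr hb0
  set f := b⁻¹ * c with hf
  have hfv : v p ^ K ≤ v f := by
    rw [hf, map_mul, map_inv₀]
    exact hcv.trans (le_mul_of_one_le_left' ((one_le_inv₀ (zero_lt_iff.mpr hvb0)).mpr hbv))
  have hvf0 : v f ≠ 0 := fun h0 => by
    rw [h0, le_zero_iff] at hfv
    exact pow_ne_zero _ hγ0 hfv
  have hf0 : f ≠ 0 := (map_ne_zero v).mp hvf0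
  clear_value f
  -- For `u = 1 + y`, choose `q` with `y* = (f * r q)*`, so that `n = y(f * r q)⁻¹` lies in `N` with
  -- value below `1`. Then `n + y = n(1 + f * r q) ∈ N`, and `1 + y = (1 - n)(1 + (1 - n)⁻¹(n + y))`
  -- needs the hypothesis only for elements of `N`.
  have htriv : ∀ u ∈ congruenceSubgroup v _ (hγ (K + 1)), u ∈ N := by
    intro u hu
    rw [mem_congruenceSubgroup] at hu
    by_cases hy0 : (u : D) - 1 = 0
    · have : u = 1 := Units.ext (sub_eq_zero.mp hy0)
      rw [this]
      exact N.one_mem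
    set y := (u : D) - 1 with hy
    have hyK : v y ≤ v p ^ K * v p := by
      rw [← pow_succ]
      exact hu.trans (pow_le_pow_right_of_le_one' hp.le Nat.lt_two_pow_self.le)
    have hσf : starHom N f ≠ 0 := (map_ne_zero _).mpr hf0
    have hσy : starHom N y ≠ 0 := (map_ne_zero _).mpr hy0
    let q : Dˣ ⧸ N := ((Units.mk0 f hf0)⁻¹ * Units.mk0 y hy0 : Dˣ)
    have hq : starHom N (r q : D) = (starHom N f)⁻¹ * starHom N y := by
      rw [starHom_coe, hr2]
      simp only [q]
      rw [← starHom_coe]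
      simp
    have hfr0 : f * r q ≠ 0 := mul_ne_zero hf0 (r q).ne_zero
    set n := y * (f * r q)⁻¹ with hn
    have hnσ : starHom N n = 1 := by
      rw [hn, map_mul, map_inv₀, map_mul, hq, mul_inv_cancel_left₀ hσf, mul_inv_cancel₀ hσy]
    have hnv : v n < 1 := by
      rw [hn, map_mul, map_inv₀, map_mul, hr1, mul_one, ← div_eq_mul_inv]
      refine lt_of_le_of_lt ?_ hp
      rw [div_le_iff₀ (zero_lt_iff.mpr hvf0), mul_comm]
      exact hyK.trans (mul_le_mul_left hfv _)
    have hyv : v y < 1 := lt_of_le_of_lt hu (hγ _)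
    have hny : n * (1 + f * r q) = n + y := by
      rw [mul_add, mul_one, hn, inv_mul_cancel_right₀ hfr0]
    have h1 : starHom N (1 + -n) = 1 := hv _ (by rw [starHom_neg hneg, hnσ]) (by rwa [v.map_neg])
    have h1v : v (1 + -n) = 1 := v.map_one_add_of_lt (by rwa [v.map_neg])
    have h10 : 1 + -n ≠ 0 := fun h0 => by rw [h0, map_zero] at h1v; exact zero_ne_one h1v
    have h2 : starHom N (1 + (1 + -n)⁻¹ * (n * (1 + f * r q))) = 1 := by
      refine hv _ ?_ ?_
      · rw [map_mul, map_mul, map_inv₀, h1, hnσ, h q, inv_one, one_mul, one_mul]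
      · rw [map_mul, map_inv₀, h1v, inv_one, one_mul, hny]
        exact v.map_add_lt hnv hyv
    have h3 : (u : D) = (1 + -n) * (1 + (1 + -n)⁻¹ * (n * (1 + f * r q))) := by
      rw [mul_add, mul_one, mul_inv_cancel_left₀ h10, hny, hy]
      abel
    rw [← starHom_coe_eq_one N, h3, map_mul, h1, h2, one_mul]
  have hbot : (congruenceSubgroup v _ (hγ (K + 1))).map (QuotientGroup.mk' N) = ⊥ := by
    rw [eq_bot_iff]
    rintro _ ⟨u, hu, rfl⟩
    rw [Subgroup.mem_bot, QuotientGroup.mk'_apply, QuotientGroup.eq_one_iff]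
    exact htriv u hu
  rw [himage] at hbot
  exact top_ne_bot hbot

end OneAdd

end DivGroup

namespace DivGroup

/-! ### Assembling the theorem -/

section Main

variable {D : Type*} [DivisionRing D] {N : Subgroup Dˣ} [N.Normal]

theorem infinite_of_nonabelian (hnonabelian : ∃ x y : Dˣ ⧸ N, x * y ≠ y * x) : Infinite D := by
  by_contra hfin
  rw [not_infinite_iff_finite] at hfin
  obtain ⟨x, y, hxy⟩ := hnonabelian
  obtain ⟨a, rfl⟩ := QuotientGroup.mk_surjective x
  obtain ⟨b, rfl⟩ := QuotientGroup.mk_surjective y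
  refine hxy ?_
  rw [← QuotientGroup.mk_mul, ← QuotientGroup.mk_mul]
  congr 1
  ext
  exact (littleWedderburn D).mul_comm a b

theorem Dom.exists_of_mem_carrier {x y z : Dˣ ⧸ N} (h : Dom N (x : WithZero (Dˣ ⧸ N)) y)
    (hz : z ∈ (ConjClasses.mk y).carrier) :
    ∃ g : Dˣ ⧸ N, z = g * y * g⁻¹ ∧
      Dom N ((g * x * g⁻¹ : Dˣ ⧸ N) : WithZero (Dˣ ⧸ N)) (z : WithZero (Dˣ ⧸ N)) := by
  rw [ConjClasses.mem_carrier_iff_mk_eq, ConjClasses.mk_eq_mk_iff_isConj] at hz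
  obtain ⟨g, hg⟩ := isConj_iff.mp hz.symm
  obtain ⟨u, rfl⟩ := QuotientGroup.mk_surjective g
  refine ⟨u, hg.symm, ?_⟩
  have := h.conj u
  rw [starHom_coe] at this
  rw [← hg]
  exact this

theorem mk_ne_one {X : Type*} [Group X] {x : X} (hx : x ≠ 1) : ConjClasses.mk x ≠ 1 := by
  rw [ConjClasses.one_eq_mk_one]
  intro h
  exact hx (by simpa using ConjClasses.mk_eq_mk_iff_isConj.mp h)

theorem isDiamPair_of_dom [Infinite D] [Finite (Dˣ ⧸ N)] (hneg : starHom N (-1 : D) = 1)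
    {x y : {x : Dˣ ⧸ N // x ≠ 1}} (hxy : 4 < (commutingGraph (Dˣ ⧸ N)).edist x y)
    (h : Dom N ((x : Dˣ ⧸ N) : WithZero (Dˣ ⧸ N)) ((y : Dˣ ⧸ N) : WithZero (Dˣ ⧸ N))) :
    IsDiamPair N (ConjClasses.mk (x : Dˣ ⧸ N)) (ConjClasses.mk (y : Dˣ ⧸ N)) := by
  refine ⟨mk_ne_one x.2, mk_ne_one y.2, uHypothesis_of_dom hneg (mk_ne_one y.2) fun z hz => ?_, ?_⟩
  · obtain ⟨g, -, hg⟩ := h.exists_of_mem_carrier hz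
    exact ⟨_, hg⟩
  · intro b hb
    simp only [pClass, Set.mem_iUnion] at hb
    obtain ⟨z, hz, hbz, hb1⟩ := hb
    obtain ⟨g, hgz, -, hg⟩ := h.exists_of_mem_carrier hz
    rw [mem_nSet_iff, Units.val_one] at hb1
    obtain ⟨a, ha, ha1, hab⟩ := hg b (by rw [starHom_coe, hbz]) hb1.2
    have ha0 : a ≠ 0 := by
      rintro rfl
      simp at ha
    have haq : ((Units.mk0 a ha0 : Dˣ) : Dˣ ⧸ N) = g * x * g⁻¹ := by
      rw [← WithZero.coe_inj, ← starHom_coe, Units.val_mk0, ha]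
    have hne : ∀ w : {x : Dˣ ⧸ N // x ≠ 1}, g * w * g⁻¹ ≠ 1 := fun w hw =>
      w.2 (by simpa using hw)
    refine ⟨Units.mk0 a ha0, ?_, ⟨?_, ?_, ?_⟩, ?_⟩
    · simp only [pClass, Set.mem_iUnion]
      refine ⟨_, ?_, haq, ?_⟩
      · rw [ConjClasses.mem_carrier_iff_mk_eq, ConjClasses.mk_eq_mk_iff_isConj]
        exact (isConj_iff.mpr ⟨g, rfl⟩).symm
      · rw [mem_nSet_iff, Units.val_one]
        exact ⟨map_one _, ha1⟩
    · rw [haq]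
      exact hne x
    · rw [hbz, hgz]
      exact hne y
    · simp only [haq, hbz, hgz]
      exact hxy.trans_le (edist_conj g x.2 y.2 (hne x) (hne y))
    · intro n hn
      rw [mem_nSet_iff] at hn ⊢
      exact hab hn

variable {F : Type*} [Field F] [Algebra F D] [Algebra.IsCentral F D] [FiniteDimensional F D]
  [Finite (Dˣ ⧸ N)] [IsSimpleGroup (Dˣ ⧸ N)]

theorem starHom_one_add_of_uHypothesis (hnonabelian : ∃ x y : Dˣ ⧸ N, x * y ≠ y * x)
    {S : Set Dˣ} (h : UHypothesis N S)
    {Γ : Type*} [LinearOrderedCommGroupWithZero Γ] (v : Valuation D Γ)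
    (hv : ∀ n ∈ N, v n < 1 ↔ n ∉ S) {d : D} (hd : v d < 1) : starHom N (1 + d) = 1 := by
  have hneg : starHom N (-1 : D) = 1 := by
    have := (starHom_coe_eq_one N).mpr (h.ssubset.1 h.neg_one_mem)
    rwa [Units.val_neg, Units.val_one] at this
  refine starHom_one_add_of_lt_one hnonabelian hneg v (fun d hd hdv => ?_) hd
  obtain ⟨n, hn, rfl⟩ := (starHom_eq_one_iff N).mp hd
  obtain ⟨u, hu, huS, -⟩ := h.exists_eq_one_add hn ((hv n hn).mp hdv)
  rw [← hu, starHom_coe_eq_one]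
  exact h.ssubset.1 huS

omit [N.Normal] [Finite (Dˣ ⧸ N)] [IsSimpleGroup (Dˣ ⧸ N)] in
theorem one_lt_valuation_iff {Γ : Type*} [LinearOrderedCommGroupWithZero Γ] (v : Valuation D Γ)
    {S : Set Dˣ} (hv : ∀ n ∈ N, v n < 1 ↔ n ∉ S) {n : Dˣ} (hn : n ∈ N) :
    1 < v n ↔ n⁻¹ ∉ S := by
  rw [← hv _ (N.inv_mem hn), Units.val_inv_eq_inv_val, map_inv₀,
    inv_lt_one₀ (zero_lt_iff.mpr ((map_ne_zero v).mpr n.ne_zero))]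

/-- Consequences of the `U`-Hypothesis for `ℕ_C`: the description of `K̂_C`, and `𝕄_C ⊆ N(a)` for each
`a` in some `𝕆_x`. -/
theorem kHat_eq_and_mem_nSet
    (hFN : ∀ (α : F) (a : Dˣ), (a : D) = algebraMap F D α → a ∈ N)
    (hnonabelian : ∃ x y : Dˣ ⧸ N, x * y ≠ y * x) {C : ConjClasses (Dˣ ⧸ N)}
    (h : UHypothesis N (nClass N C)) :
    kHat N F C = (normOne F * uClass N C) \ (N : Set Dˣ) ∧
      ∀ m ∈ mClass N C, ∀ a : Dˣ, -1 ∉ nSet N a ∪ nSet N a⁻¹ → m ∈ nSet N a := by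
  obtain ⟨Γ, _, v, hv, hv1⟩ := h.exists_valuation hFN
  have key : ∀ {d : D}, v d < 1 → starHom N (1 + d) = 1 := fun hd =>
    starHom_one_add_of_uHypothesis hnonabelian h v hv hd
  have hneg : starHom N (-1 : D) = 1 := by
    have := (starHom_coe_eq_one N).mpr (h.ssubset.1 h.neg_one_mem)
    rwa [Units.val_neg, Units.val_one] at this
  have hone : ∀ m ∈ mClass N C, ∀ a : Dˣ, v (a : D) = 1 → m ∈ nSet N a := by
    rintro m ⟨hm, hmU⟩ a ha
    have hmN := h.ssubset.1 hm
    have hmv : 1 < v (m : D) := (one_lt_valuation_iff v hv hmN).mpr fun h' => hmU ⟨hmN, hm, h'⟩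
    have hmσ := (starHom_coe_eq_one N).mpr hmN
    rw [mem_nSet_iff]
    refine ⟨hmσ, ?_⟩
    have h1 : (a : D) + m = m * (1 + (m : D)⁻¹ * a) := by
      rw [mul_add, mul_one, mul_inv_cancel_left₀ m.ne_zero, add_comm]
    rw [h1, map_mul, hmσ, one_mul]
    refine key ?_
    rw [map_mul, ha, mul_one, map_inv₀]
    exact inv_lt_one_of_one_lt₀ hmv
  refine ⟨Set.Subset.antisymm (fun a ha => ha.1) fun a ha => ⟨ha, ?_⟩, fun m hm a ha => hone m hm a ?_⟩
  · intro m hm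
    refine hone m hm a ?_
    obtain ⟨⟨o, ho, u, ⟨huN, hu1, hu2⟩, rfl⟩, -⟩ := ha
    have ho1 : v (o : D) = 1 := hv1 _ (norm_eq_one_of_isReducedNorm ho)
    have hu : v (u : D) = 1 := le_antisymm
      (not_lt.mp fun h' => (one_lt_valuation_iff v hv huN).mp h' hu2)
      (not_lt.mp fun h' => (hv u huN).mp h' hu1)
    change v ((o * u : Dˣ) : D) = 1
    rw [Units.val_mul, map_mul, ho1, hu, one_mul]
  · rw [Set.mem_union, not_or, mem_nSet_iff, mem_nSet_iff, Units.val_neg, Units.val_one] at ha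
    have hflip : ∀ d : D, starHom N (d + -1) = starHom N (1 + -d) := fun d => by
      rw [← starHom_neg hneg, neg_add, neg_neg, add_comm]
    -- If `v a` were not `1`, then `a` or `a⁻¹` would have value below `1`, which puts `-1` in
    -- `N(a)` or `N(a⁻¹)`.
    refine le_antisymm (not_lt.mp fun h' => ha.2 ⟨hneg, ?_⟩) (not_lt.mp fun h' => ha.1 ⟨hneg, ?_⟩)
    · rw [hflip]
      refine key ?_
      rw [v.map_neg, Units.val_inv_eq_inv_val, map_inv₀]
      exact inv_lt_one_of_one_lt₀ h'
    · rw [hflip]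
      exact key (by rwa [v.map_neg])

/-- The second alternative always holds, with `z = y` for every `m`, since elements of `𝕆_y` have
value `1`. -/
theorem isBalancedClass_of_dom
    (hFN : ∀ (α : F) (a : Dˣ), (a : D) = algebraMap F D α → a ∈ N)
    (hnonabelian : ∃ x y : Dˣ ⧸ N, x * y ≠ y * x) [Infinite D] (hneg : starHom N (-1 : D) = 1)
    {x y : Dˣ ⧸ N} (hy : y ≠ 1)
    (h : Dom N (x : WithZero (Dˣ ⧸ N)) (y : WithZero (Dˣ ⧸ N))) :
    IsBalancedClass N (ConjClasses.mk y) := by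
  have hU : UHypothesis N (nClass N (ConjClasses.mk y)) :=
    uHypothesis_of_dom hneg (mk_ne_one hy) fun z hz => by
      obtain ⟨g, -, hg⟩ := h.exists_of_mem_carrier hz
      exact ⟨_, hg⟩
  refine ⟨mk_ne_one hy, hU, Or.inr fun m hm => ⟨y, ConjClasses.mem_carrier_mk, fun z hz => ?_⟩⟩
  exact (kHat_eq_and_mem_nSet hFN hnonabelian hU).2 m hm z hz.2

end Main

end DivGroup

theorem mainTheorem2 {F D : Type*} [Field F] [DivisionRing D] [Algebra F D]
    [Algebra.IsCentral F D] [FiniteDimensional F D]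
    (N : Subgroup Dˣ) [N.Normal] [Finite (Dˣ ⧸ N)]
    (hFN : ∀ (α : F) (a : Dˣ), (a : D) = algebraMap F D α → a ∈ N)
    [IsSimpleGroup (Dˣ ⧸ N)] (hnonabelian : ∃ x y : Dˣ ⧸ N, x * y ≠ y * x) :
    (4 < (DivGroup.commutingGraph (Dˣ ⧸ N)).ediam →
      (∃ A B : ConjClasses (Dˣ ⧸ N), DivGroup.IsDiamPair N A B) ∧
      ∀ A B : ConjClasses (Dˣ ⧸ N), DivGroup.IsDiamPair N A B →
        DivGroup.kHat N F B = (DivGroup.normOne F * DivGroup.uClass N B) \ (N : Set Dˣ)) ∧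
    (DivGroup.IsBalanced (Dˣ ⧸ N) →
      (∃ C : ConjClasses (Dˣ ⧸ N), DivGroup.IsBalancedClass N C) ∧
      ∀ C : ConjClasses (Dˣ ⧸ N), DivGroup.IsBalancedClass N C →
        DivGroup.kHat N F C = (DivGroup.normOne F * DivGroup.uClass N C) \ (N : Set Dˣ)) := by
  have hinf := DivGroup.infinite_of_nonabelian hnonabelian
  have hneg : DivGroup.starHom N (-1 : D) = 1 := by
    have := (DivGroup.starHom_coe_eq_one N).mpr (hFN (-1) (-1) (by simp))
    rwa [Units.val_neg, Units.val_one] at this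
  have hcoe : ∀ x : {x : Dˣ ⧸ N // x ≠ 1}, ((x : Dˣ ⧸ N) : WithZero (Dˣ ⧸ N)) ≠ 1 := fun x h =>
    x.2 (WithZero.coe_inj.mp (h.trans WithZero.coe_one.symm))
  refine ⟨fun hdiam => ⟨?_, fun A B h =>
    (DivGroup.kHat_eq_and_mem_nSet hFN hnonabelian h.uHypothesis).1⟩,
    fun hbal => ⟨?_, fun C h =>
    (DivGroup.kHat_eq_and_mem_nSet hFN hnonabelian h.uHypothesis).1⟩⟩
  · rw [SimpleGraph.ediam_eq_iSup_iSup_edist, lt_iSup_iff] at hdiam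
    obtain ⟨x, hx⟩ := hdiam
    obtain ⟨y, hxy⟩ := lt_iSup_iff.mp hx
    rcases (DivGroup.goodPair_of_far4 hneg (hcoe x) WithZero.coe_ne_zero (hcoe y)
      (DivGroup.far4_of_lt_edist hxy)).dom_or_dom with h | h
    · exact ⟨_, _, DivGroup.isDiamPair_of_dom hneg hxy h⟩
    · exact ⟨_, _, DivGroup.isDiamPair_of_dom hneg (by rwa [SimpleGraph.edist_comm]) h⟩
  · obtain ⟨x, y, z, w, -, hw, hxy, -, -, hxw, hyw⟩ := hbal
    have hw' : ((w : Dˣ ⧸ N) : WithZero (Dˣ ⧸ N)) =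
        ((x : Dˣ ⧸ N) : WithZero (Dˣ ⧸ N))⁻¹ * ((y : Dˣ ⧸ N) : WithZero (Dˣ ⧸ N)) := by
      rw [hw, WithZero.coe_mul, WithZero.coe_inv]
    have h1 := DivGroup.far3_of_lt_edist hxw
    have h2 := DivGroup.far3_of_lt_edist hyw
    rw [hw'] at h1 h2
    rcases (DivGroup.goodPair_of_far3 hneg WithZero.coe_ne_zero (hcoe x) WithZero.coe_ne_zero
      (hcoe y) (DivGroup.far3_of_lt_edist hxy) h1 h2).dom_or_dom with h | h
    · exact ⟨_, DivGroup.isBalancedClass_of_dom hFN hnonabelian hneg y.2 h⟩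
    · exact ⟨_, DivGroup.isBalancedClass_of_dom hFN hnonabelian hneg x.2 h⟩
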